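/- Let $\mathrm{Homeo}_0(\mathbb{R})$ be the group of orientation-preserving homeomorphisms of $\mathbb{R}$. An action $\varphi\colon G\to \mathrm{Homeo}_0(\mathbb{R})$ (a group homomorphism) is \emph{irreducible} if it has no global fixed point, \emph{minimal} if every orbit is dense in $\mathbb{R}$, \emph{affine} if every $\varphi(g)$ has the form $x\mapsto ax+b$ with $a>0$ and $b\in\mathbb{R}$, and \emph{cyclic} if every $\varphi(g)$ is a translation by an integer. Two actions $\varphi,\psi$ are \emph{conjugate} if there is a homeomorphism $h$ of $\mathbb{R}$ with $h\circ\varphi(g)=\psi(g)\circ h$ for all $g\in G$. A \emph{prelamination} is a collection $\mathcal{L}$ of non-empty bounded open intervals of $\mathbb{R}$ that are pairwise nested or disjoint; it is a \emph{lamination} if it is closed in the space $\{(x,y)\in\mathbb{R}^2 : x<y\}$ of such intervals, and it is \emph{covering} if its elements cover $\mathbb{R}$. An irreducible action is \emph{laminar} if it preserves a covering prelamination. A laminar action $\varphi$ is \emph{horograded} by an irreducible action $j\colon G\to\mathrm{Homeo}_0(\mathbb{R})$ if there are a $\varphi$-invariant covering lamination $\mathcal{L}$ and a map $\mathfrak{h}\colon\mathcal{L}\to\mathbb{R}$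 such that $\mathfrak{h}(I)\le\mathfrak{h}(J)$ whenever $I\subseteq J$, and $\mathfrak{h}(\varphi(g)(I))=j(g)(\mathfrak{h}(I))$ for all $g\in G$ and $I\in\mathcal{L}$. \textbf{Theorem D.} Let $G$ be a finitely generated virtually solvable group and let $\varphi\colon G\to\mathrm{Homeo}_0(\mathbb{R})$ be a minimal action. Then exactly one of the following holds: (1) $\varphi$ is conjugate to an affine action; (2) $\varphi$ is laminar. In case (2), $\varphi$ can be horograded by an (irreducible) action $j\colon G\to\mathrm{Homeo}_0(\mathbb{R})$ that is minimal or cyclic and that factors through $G/\mathrm{Fit}(G)$, where the Fitting subgroup $\mathrm{Fit}(G)$ is the subgroup of $G$ generated by all nilpotent normal subgroups of $G$. -/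

import Mathlib

namespace LineAction

/-- The group of orientation-preserving homeomorphisms of the real line. An increasing bijection of
`ℝ` is automatically a homeomorphism, so this is the group of order automorphisms of `ℝ`. -/
abbrev HomeoPlus : Type := ℝ ≃o ℝ

/-- The group `G` contains a solvable subgroup of finite index. -/
def IsVirtuallySolvable (G : Type*) [Group G] : Prop :=
  ∃ H : Subgroup G, Group.IsSolvable H ∧ H.FiniteIndex

/-- The Fitting subgroup: the subgroup generated by all nilpotent normal subgroups. -/
def fitting (G : Type*) [Group G] : Subgroup G :=
  sSup {N : Subgroup G | N.Normal ∧ Group.IsNilpotent N}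

variable {G : Type*} [Group G]

/-- No point of the line is fixed by the whole group. -/
def IsIrreducible (φ : G →* HomeoPlus) : Prop :=
  ∀ x : ℝ, ∃ g : G, φ g x ≠ x

/-- Every orbit is dense. -/
def IsMinimal (φ : G →* HomeoPlus) : Prop :=
  ∀ x : ℝ, Dense (Set.range fun g : G => φ g x)

/-- The action takes values in the group of integer translations. -/
def IsCyclic (φ : G →* HomeoPlus) : Prop :=
  ∀ g : G, ∃ n : ℤ, ∀ x : ℝ, φ g x = x + n

/-- The action takes values in the group of maps `x ↦ a * x + b` with `a > 0`. -/
def IsAffine (φ : G →* HomeoPlus) : Prop :=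
  ∀ g : G, ∃ a b : ℝ, 0 < a ∧ ∀ x : ℝ, φ g x = a * x + b

/-- The two actions are conjugate by a homeomorphism of the line. -/
def IsConjugate (φ ψ : G →* HomeoPlus) : Prop :=
  ∃ h : ℝ ≃ₜ ℝ, ∀ (g : G) (x : ℝ), h (φ g x) = ψ g (h x)

/-- The space of non-empty bounded open intervals of the line, identified with the space of pairs
`(x, y)` with `x < y`, and with the topology induced from `ℝ × ℝ`. -/
abbrev OpenInterval : Type := {p : ℝ × ℝ // p.1 < p.2}

/-- The set of points of an interval. -/
def OpenInterval.toSet (I : OpenInterval) : Set ℝ := Set.Ioo I.1.1 I.1.2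

/-- The image of an interval under an orientation-preserving homeomorphism. -/
def OpenInterval.map (f : HomeoPlus) (I : OpenInterval) : OpenInterval :=
  ⟨(f I.1.1, f I.1.2), f.strictMono I.2⟩

/-- A collection of intervals that are pairwise nested or disjoint. -/
def IsPrelamination (L : Set OpenInterval) : Prop :=
  ∀ I ∈ L, ∀ J ∈ L, I.toSet ⊆ J.toSet ∨ J.toSet ⊆ I.toSet ∨ Disjoint I.toSet J.toSet

/-- A prelamination that is closed in the space of intervals. -/
def IsLamination (L : Set OpenInterval) : Prop :=
  IsPrelamination L ∧ IsClosed L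

/-- The collection of intervals covers the line. -/
def IsCovering (L : Set OpenInterval) : Prop :=
  ∀ x : ℝ, ∃ I ∈ L, x ∈ I.toSet

/-- The collection of intervals is preserved by the action. -/
def IsInvariant (φ : G →* HomeoPlus) (L : Set OpenInterval) : Prop :=
  ∀ g : G, ∀ I ∈ L, I.map (φ g) ∈ L

/-- An irreducible action that preserves a covering prelamination. -/
def IsLaminar (φ : G →* HomeoPlus) : Prop :=
  IsIrreducible φ ∧ ∃ L : Set OpenInterval, IsPrelamination L ∧ IsCovering L ∧ IsInvariant φ L

/-- `(L, hor)` is a (positive) horograding of the action `φ` by the action `j`. -/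
structure IsHorograding (φ j : G →* HomeoPlus) (L : Set OpenInterval) (hor : L → ℝ) : Prop where
  laminar : IsLaminar φ
  irreducible : IsIrreducible j
  lamination : IsLamination L
  covering : IsCovering L
  invariant : IsInvariant φ L
  monotone : ∀ I J : L, I.1.toSet ⊆ J.1.toSet → hor I ≤ hor J
  equivariant : ∀ (g : G) (I : L),
    hor ⟨I.1.map (φ g), invariant g I.1 I.2⟩ = j g (hor I)

/-- The action `φ` can be horograded by the action `j`. -/
def IsHorogradedBy (φ j : G →* HomeoPlus) : Prop :=
  ∃ (L : Set OpenInterval) (hor : L → ℝ), IsHorograding φ j L hor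

end LineAction

/-! Let A be the last term acting non-trivially in the derived series of a solvable normal subgroup
of finite index. Its image is abelian, and A is normal.

Suppose some element of A moves every point. Then A acts freely, and Hölder's theorem gives it
translation numbers. If these are dense, they straighten A to translations and `G`, which normalises
A, to affine maps (`IsMinimal.isConjugateToAffine_of_dense`). If they are discrete, the image of A
is generated by one fixed-point-free map commuting with `G`. No commutator is a non-trivial power of
such a map (`eq_zero_of_commutator_eq_zpow`), so A can absorb the next larger term of the series and
stay abelian in the image. This cannot remain discrete up to finite index, because orbits are dense.

Suppose instead every element of A has a fixed point. The components of supports of elements of A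
form an invariant prelamination. Elements of the Fitting subgroup are left Engel, so none strictly
enlarges a component (`isElliptic_supportComponents`). Now climb the series again: if N enlarges no
interval and B is abelian modulo N, either some sublamination is not enlarged by B, or B pushes
every interval over the whole line and any two intervals become nested up to N
(`comparable_of_commute`). Finite generation stops the first alternative before finite index
(`exists_total_lamination`). The translates of one interval then define a left-invariant total
preorder on `G`. A maximal proper cone containing its non-negative cone gives either a homomorphism
to the integers or a dense countable order, hence a cyclic or minimal action j killing N
(`exists_action_of_cone`). The height of I is the infimum of the positions of the translates
containing I.

The alternatives exclude each other because a minimal affine action contains arbitrarily small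
translations, which make a bounded interval cross its image. -/

namespace LineAction
variable {G : Type*} [Group G]

/-! ### Extending order-preserving actions from a dense subset. -/

section DenseExtension

variable {u : G → ℝ}

/-- The monotone extension to the line of the left multiplication by `g` on the image of `u`. -/
noncomputable def extension (u : G → ℝ) (g : G) (x : ℝ) : ℝ :=
  sSup ((fun a => u (g * a)) '' {a | u a ≤ x})

theorem extension_nonempty (hd : DenseRange u) (g : G) (x : ℝ) :
    ((fun a => u (g * a)) '' {a | u a ≤ x}).Nonempty := by
  obtain ⟨_, ⟨a, rfl⟩, ha⟩ := hd.exists_lt x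
  exact ⟨_, a, ha.le, rfl⟩

theorem extension_bddAbove (hd : DenseRange u)
    (hu : ∀ g a b, u a ≤ u b → u (g * a) ≤ u (g * b)) (g : G) (x : ℝ) :
    BddAbove ((fun a => u (g * a)) '' {a | u a ≤ x}) := by
  obtain ⟨_, ⟨b, rfl⟩, hb⟩ := hd.exists_gt x
  refine ⟨u (g * b), ?_⟩
  rintro _ ⟨a, ha, rfl⟩
  exact hu g a b (le_trans ha hb.le)

theorem extension_apply (hu : ∀ g a b, u a ≤ u b → u (g * a) ≤ u (g * b)) (g a : G) :
    extension u g (u a) = u (g * a) := by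
  refine IsGreatest.csSup_eq ⟨⟨a, le_refl (u a), rfl⟩, ?_⟩
  rintro _ ⟨b, hb, rfl⟩
  exact hu g b a hb

theorem extension_monotone (hd : DenseRange u)
    (hu : ∀ g a b, u a ≤ u b → u (g * a) ≤ u (g * b)) (g : G) : Monotone (extension u g) := by
  intro x y hxy
  refine csSup_le_csSup (extension_bddAbove hd hu g y) (extension_nonempty hd g x)
    (Set.image_mono fun a ha => le_trans ha hxy)

/-- A monotone map with dense range has no jumps; the range contains that of `u` because left
multiplication permutes `G`. -/
theorem extension_continuous (hd : DenseRange u)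
    (hu : ∀ g a b, u a ≤ u b → u (g * a) ≤ u (g * b)) (g : G) : Continuous (extension u g) := by
  refine (extension_monotone hd hu g).continuous_of_denseRange (hd.mono ?_)
  rintro _ ⟨a, rfl⟩
  exact ⟨u (g⁻¹ * a), by rw [extension_apply hu]; simp⟩

theorem extension_mul (hd : DenseRange u)
    (hu : ∀ g a b, u a ≤ u b → u (g * a) ≤ u (g * b)) (g h : G) (x : ℝ) :
    extension u (g * h) x = extension u g (extension u h x) := by
  have := hd.equalizer (extension_continuous hd hu (g * h))
    ((extension_continuous hd hu g).comp (extension_continuous hd hu h)) (by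
      funext a
      simp [extension_apply hu, mul_assoc])
  exact congrFun this x

theorem extension_one (hd : DenseRange u)
    (hu : ∀ g a b, u a ≤ u b → u (g * a) ≤ u (g * b)) (x : ℝ) : extension u 1 x = x := by
  have := hd.equalizer (extension_continuous hd hu 1) continuous_id (by
      funext a
      simp [extension_apply hu])
  exact congrFun this x

/-- An order-preserving action on a dense subset of the line extends to the line. -/
theorem exists_action_of_denseRange (hd : DenseRange u)
    (hu : ∀ g a b, u a ≤ u b → u (g * a) ≤ u (g * b)) :
    ∃ j : G →* HomeoPlus, ∀ g a, j g (u a) = u (g * a) := by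
  refine ⟨MonoidHom.mk' (fun g => Equiv.toOrderIso
    ⟨extension u g, extension u g⁻¹, fun x => ?_, fun x => ?_⟩
    (extension_monotone hd hu g) (extension_monotone hd hu g⁻¹)) ?_, fun g a => ?_⟩
  · rw [← extension_mul hd hu, inv_mul_cancel, extension_one hd hu]
  · rw [← extension_mul hd hu, mul_inv_cancel, extension_one hd hu]
  · intro g h
    ext x
    exact extension_mul hd hu g h x
  · exact extension_apply hu g a

end DenseExtension

/-! ### Maximal cones and the actions they define. -/

/-- A proper submonoid of a finitely generated group is contained in a maximal one. -/
theorem exists_maximal_cone [Group.FG G] (P₀ : Submonoid G)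
    (hne : P₀ ≠ ⊤) :
    ∃ P : Submonoid G, P₀ ≤ P ∧ P ≠ ⊤ ∧ ∀ Q : Submonoid G, P ≤ Q → Q ≠ ⊤ → Q = P := by
  obtain ⟨S, hS⟩ := Monoid.fg_def.1 (Group.fg_iff_monoid_fg.1 (inferInstance : Group.FG G))
  obtain ⟨P, hP, hmax⟩ := zorn_le_nonempty₀ {P : Submonoid G | P ≠ ⊤} (by
    intro c hc hchain y hy
    refine ⟨sSup c, fun htop => ?_, fun z hz => le_sSup hz⟩
    have hmem : ∀ x : G, ∃ s ∈ c, x ∈ s := fun x =>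
      (Submonoid.mem_sSup_of_directedOn ⟨y, hy⟩ hchain.directedOn).1 (htop ▸ Submonoid.mem_top x)
    -- A finite generating set contained in the union of a chain is already contained in one member.
    have : ∀ T : Finset G, ∃ s ∈ c, (T : Set G) ⊆ s := by
      classical
      intro T
      induction T using Finset.induction_on with
      | empty => exact ⟨y, hy, by simp⟩
      | insert a T _ ih =>
        obtain ⟨s, hs, hTs⟩ := ih
        obtain ⟨t, ht, hat⟩ := hmem a
        obtain ⟨r, hr, hsr, htr⟩ := hchain.directedOn s hs t ht
        refine ⟨r, hr, ?_⟩
        rw [Finset.coe_insert]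
        exact Set.insert_subset (htr hat) (hTs.trans hsr)
    obtain ⟨s, hs, hSs⟩ := this S
    exact hc hs (top_le_iff.1 (hS ▸ Submonoid.closure_le.2 hSs))) P₀ hne
  exact ⟨P, hP, hmax.1, fun Q hQ hQt => le_antisymm (hmax.2 hQt hQ) hQ⟩

theorem countable_of_fg [Group.FG G] : Countable G := by
  obtain ⟨S, hS, φ, hφ⟩ :=
    Group.fg_iff_exists_freeGroup_hom_surjective_finite.1 (inferInstance : Group.FG G)
  have : Countable (FreeGroup S) := inferInstance
  exact hφ.countable

section Cone

variable {P : Submonoid G}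

/-- A total submonoid without gaps is the non-negative cone of a dense countable order. -/
theorem exists_denseRange_of_cone [Countable G] (htot : ∀ g, g ∈ P ∨ g⁻¹ ∈ P) (hne : P ≠ ⊤)
    (hdense : ∀ p ∈ P, p⁻¹ ∉ P → ∃ q ∈ P, q⁻¹ ∉ P ∧ q⁻¹ * p ∈ P ∧ (q⁻¹ * p)⁻¹ ∉ P) :
    ∃ u : G → ℝ, DenseRange u ∧ ∀ a b, u a ≤ u b ↔ a⁻¹ * b ∈ P := by
  classical
  let : Preorder G :=
    { le := fun a b => a⁻¹ * b ∈ P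
      le_refl := fun a => by simp
      le_trans := fun a b c hab hbc => by
        have := P.mul_mem hab hbc
        rwa [show a⁻¹ * b * (b⁻¹ * c) = a⁻¹ * c by group] at this }
  have le_def : ∀ a b : G, a ≤ b ↔ a⁻¹ * b ∈ P := fun a b => Iff.rfl
  have : Std.Total (α := G) (· ≤ ·) := ⟨fun a b => by
    rw [le_def, le_def]
    simpa using htot (a⁻¹ * b)⟩
  have lt_def : ∀ a b : G, a < b ↔ a⁻¹ * b ∈ P ∧ (a⁻¹ * b)⁻¹ ∉ P := fun a b => by
    rw [lt_iff_le_not_ge, le_def, le_def]; simp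
  let Ω := Antisymmetrization G (· ≤ ·)
  have surj : ∀ x : Ω, ∃ a, toAntisymmetrization (· ≤ ·) a = x := Quotient.exists_rep
  obtain ⟨z, hz⟩ : ∃ z, z ∉ P := by
    by_contra! h
    exact hne (top_le_iff.1 fun x _ => h x)
  have hz' : z⁻¹ ∈ P := (htot z).resolve_left hz
  have hlt : ∀ a b : G, toAntisymmetrization (· ≤ ·) a < toAntisymmetrization (· ≤ ·) b ↔ a < b :=
    fun a b => Iff.rfl
  have hle : ∀ a b : G, toAntisymmetrization (· ≤ ·) a ≤ toAntisymmetrization (· ≤ ·) b ↔ a ≤ b :=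
    fun a b => Iff.rfl
  have : Countable Ω := inferInstanceAs (Countable (Quotient _))
  have : Nonempty Ω := ⟨toAntisymmetrization (· ≤ ·) 1⟩
  have : NoMaxOrder Ω := ⟨fun a => by
    obtain ⟨a, rfl⟩ := surj a
    exact ⟨toAntisymmetrization (· ≤ ·) (a * z⁻¹), by
        rw [hlt, lt_def]; simp [hz, hz']⟩⟩
  have : NoMinOrder Ω := ⟨fun a => by
    obtain ⟨a, rfl⟩ := surj a
    exact ⟨toAntisymmetrization (· ≤ ·) (a * z), by
        rw [hlt, lt_def]; simp [hz, hz']⟩⟩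
  have : DenselyOrdered Ω := ⟨fun a b => by
    obtain ⟨a, rfl⟩ := surj a
    obtain ⟨b, rfl⟩ := surj b
    intro hab
    rw [hlt, lt_def] at hab
    obtain ⟨q, hq, hq', hqp, hqp'⟩ := hdense _ hab.1 hab.2
    refine ⟨toAntisymmetrization (· ≤ ·) (a * q), ?_, ?_⟩
    · rw [hlt, lt_def]; simp [hq, hq']
    · rw [hlt, lt_def]
      rw [show (a * q)⁻¹ * b = q⁻¹ * (a⁻¹ * b) by group]
      exact ⟨hqp, hqp'⟩⟩
  -- Cantor's theorem: a countable dense order without endpoints is that of the rationals.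
  obtain ⟨e⟩ := Order.iso_of_countable_dense Ω ℚ
  refine ⟨fun a => ((e (toAntisymmetrization (· ≤ ·) a) : ℚ) : ℝ), ?_, fun a b => ?_⟩
  · have : DenseRange ((↑) : ℚ → ℝ) := Rat.denseRange_cast
    refine this.mono ?_
    rintro _ ⟨q, rfl⟩
    obtain ⟨x, rfl⟩ := e.surjective q
    obtain ⟨a, rfl⟩ := surj x
    exact ⟨a, rfl⟩
  · rw [Rat.cast_le, e.le_iff_le, hle, le_def]

/-- A maximal proper total submonoid with a gap is the preimage of the non-negative integers by a
homomorphism. -/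
theorem exists_int_of_cone (htot : ∀ g, g ∈ P ∨ g⁻¹ ∈ P)
    (hmax : ∀ Q : Submonoid G, P ≤ Q → Q ≠ ⊤ → Q = P) {p : G} (hp : p ∈ P) (hp' : p⁻¹ ∉ P)
    (hgap : ∀ q ∈ P, q⁻¹ ∉ P → q⁻¹ * p ∈ P → (q⁻¹ * p)⁻¹ ∈ P) :
    ∃ u : G → ℤ, u p = 1 ∧ (∀ a b, u (a * b) = u a + u b) ∧ ∀ a ∈ P, 0 ≤ u a := by
  let _ : Preorder G :=
    { le := fun a b => a⁻¹ * b ∈ P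
      le_refl := fun a => by simp
      le_trans := fun a b c hab hbc => by
        have := P.mul_mem hab hbc
        rwa [show a⁻¹ * b * (b⁻¹ * c) = a⁻¹ * c by group] at this }
  have le_def : ∀ a b : G, a ≤ b ↔ a⁻¹ * b ∈ P := fun a b => Iff.rfl
  have left : ∀ a b c : G, c * a ≤ c * b ↔ a ≤ b := fun a b c => by
    rw [le_def, le_def, show (c * a)⁻¹ * (c * b) = a⁻¹ * b by group]
  have total : ∀ a b : G, a ≤ b ∨ b ≤ a := fun a b => by
    rw [le_def, le_def]
    simpa using htot (a⁻¹ * b)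
  have lt_of_not : ∀ a b : G, ¬ a ≤ b → b < a := fun a b h =>
    lt_iff_le_not_ge.2 ⟨(total a b).resolve_left h, h⟩
  have lt_mul : ∀ a : G, a < a * p := fun a => by
    rw [lt_iff_le_not_ge, le_def, le_def]
    simpa using ⟨hp, hp'⟩
  have gap : ∀ a x : G, a < x → x < a * p → False := by
    intro a x h1 h2
    rw [lt_iff_le_not_ge, le_def, le_def] at h1 h2
    have e : (a⁻¹ * x)⁻¹ * p = x⁻¹ * (a * p) := by group
    have := hgap (a⁻¹ * x) h1.1 (by simpa using h1.2) (by rw [e]; exact h2.1)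
    rw [e] at this
    exact h2.2 (by simpa [mul_assoc] using this)
  -- Nothing lies strictly between `a` and `a * p`, so right multiplication by `p` acts as a
  -- successor map and preserves an order that is a priori only left-invariant.
  have right : ∀ a b : G, a ≤ b → a * p ≤ b * p := by
    intro a b hab
    by_contra h
    exact gap a (b * p) (hab.trans_lt (lt_mul b)) (lt_of_not _ _ h)
  have right' : ∀ a b : G, a ≤ b → a * p⁻¹ ≤ b * p⁻¹ := by
    intro a b hab
    by_contra h
    refine gap (b * p⁻¹) (a * p⁻¹) (lt_of_not _ _ h) ?_
    have := lt_mul (a * p⁻¹)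
    rw [inv_mul_cancel_right] at this ⊢
    exact this.trans_le hab
  have right_zpow : ∀ (n : ℤ) (a b : G), a ≤ b → a * p ^ n ≤ b * p ^ n := by
    intro n
    induction n using Int.induction_on with
    | zero => simp
    | succ n ih =>
      intro a b hab
      rw [zpow_add_one, ← mul_assoc, ← mul_assoc]
      exact right _ _ (ih a b hab)
    | pred n ih =>
      intro a b hab
      rw [zpow_sub_one, ← mul_assoc, ← mul_assoc]
      exact right' _ _ (ih a b hab)
  have pow_lt : ∀ n : ℤ, p ^ n < p ^ (n + 1) := fun n => by
    rw [zpow_add_one]; exact lt_mul _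
  have pow_strict : StrictMono fun n : ℤ => p ^ n := strictMono_int_of_lt_succ pow_lt
  -- Elements bounded below by a power of `p` form a submonoid containing `P` and `p⁻¹`; maximality
  -- makes it everything, so the order is Archimedean with respect to `p`.
  let Q : Submonoid G :=
    { carrier := {g | ∃ n : ℤ, p ^ n ≤ g}
      one_mem' := ⟨0, by simp⟩
      mul_mem' := by
        rintro a b ⟨m, hm⟩ ⟨n, hn⟩
        refine ⟨m + n, ?_⟩
        rw [zpow_add]
        exact (right_zpow n _ _ hm).trans ((left _ _ _).2 hn) }
  have hQ : Q = ⊤ := by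
    by_contra h
    have hPQ : P ≤ Q := fun g hg => ⟨0, by rw [le_def]; simpa using hg⟩
    have := hmax Q hPQ h
    have hmem : p⁻¹ ∈ Q := ⟨-1, by simp⟩
    rw [this] at hmem
    exact hp' hmem
  have lower : ∀ g : G, ∃ n : ℤ, p ^ n ≤ g := fun g =>
    (hQ ▸ Submonoid.mem_top g : g ∈ Q)
  have upper : ∀ g : G, ∃ n : ℤ, g ≤ p ^ n := by
    intro g
    obtain ⟨n, hn⟩ := lower g⁻¹
    refine ⟨-n, ?_⟩
    have h1 : g * p ^ n ≤ 1 := by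
      rw [← mul_inv_cancel g]; exact (left _ _ _).2 hn
    have h2 := right_zpow (-n) _ _ h1
    rwa [mul_assoc, ← zpow_add, add_neg_cancel, zpow_zero, mul_one, one_mul] at h2
  have key : ∀ g : G, ∃ n : ℤ, p ^ n ≤ g ∧ g ≤ p ^ n := by
    intro g
    obtain ⟨m, hm⟩ := upper g
    obtain ⟨n, hn, hn'⟩ := Int.exists_greatest_of_bdd (P := fun n => p ^ n ≤ g)
      ⟨m, fun z hz => pow_strict.le_iff_le.1 (hz.trans hm)⟩ (lower g)
    refine ⟨n, hn, ?_⟩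
    by_contra h
    refine gap (p ^ n) g (lt_of_not _ _ h) (lt_of_not _ _ fun h' => ?_)
    rw [← zpow_add_one] at h'
    have := hn' _ h'
    omega
  choose u hu1 hu2 using key
  have uniq : ∀ (g : G) (n : ℤ), p ^ n ≤ g → g ≤ p ^ n → u g = n := fun g n h1 h2 =>
    le_antisymm (pow_strict.le_iff_le.1 ((hu1 g).trans h2))
      (pow_strict.le_iff_le.1 (h1.trans (hu2 g)))
  refine ⟨u, uniq _ _ (by simp) (by simp), fun a b => uniq _ _ ?_ ?_, fun a ha => ?_⟩
  · rw [zpow_add]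
    exact (right_zpow _ _ _ (hu1 a)).trans ((left _ _ _).2 (hu1 b))
  · rw [zpow_add]
    exact ((left _ _ _).2 (hu2 b)).trans (right_zpow _ _ _ (hu2 a))
  · refine pow_strict.le_iff_le.1 (?_ : p ^ (0 : ℤ) ≤ p ^ u a)
    refine le_trans ?_ (hu2 a)
    rw [le_def]; simpa using ha

end Cone

/-- The action by integer translations given by a homomorphism to the integers. -/
noncomputable def translationAction (u : G → ℤ) (hu : ∀ a b, u (a * b) = u a + u b) :
    G →* HomeoPlus :=
  MonoidHom.mk' (fun g => OrderIso.addRight (u g : ℝ)) fun a b => by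
    ext x
    simp [hu, add_comm, add_left_comm]

theorem translationAction_apply (u : G → ℤ) (hu : ∀ a b, u (a * b) = u a + u b) (g : G) (x : ℝ) :
    translationAction u hu g x = x + u g := rfl

theorem IsMinimal.isIrreducible {φ : G →* HomeoPlus} (h : IsMinimal φ) : IsIrreducible φ := by
  intro x
  by_contra! hx
  obtain ⟨_, ⟨g, rfl⟩, hg⟩ := (h x).exists_gt x
  exact hg.ne' (hx g)

/-- A proper total submonoid of a finitely generated group is non-negative for an orbit map of
some minimal or cyclic action on the line. -/
theorem exists_action_of_cone [Group.FG G] (P₀ : Submonoid G)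
    (htot : ∀ g, g ∈ P₀ ∨ g⁻¹ ∈ P₀) (hne : P₀ ≠ ⊤) :
    ∃ (j : G →* HomeoPlus) (u : G → ℝ), (∀ g a, j g (u a) = u (g * a)) ∧
      (∀ a b, a⁻¹ * b ∈ P₀ → u a ≤ u b) ∧
      (∀ g, (∀ a, u (g * a) = u a) → j g = 1) ∧
      IsIrreducible j ∧ (IsMinimal j ∨ IsCyclic j) := by
  have : Countable G := countable_of_fg
  obtain ⟨P, hP₀, hP, hmax⟩ := exists_maximal_cone P₀ hne
  have htotP : ∀ g, g ∈ P ∨ g⁻¹ ∈ P := fun g => (htot g).imp (@hP₀ _) (@hP₀ _)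
  -- A gap is a least strictly positive element; without one the order is dense.
  by_cases hgap : ∃ p ∈ P, p⁻¹ ∉ P ∧ ∀ q ∈ P, q⁻¹ ∉ P → q⁻¹ * p ∈ P → (q⁻¹ * p)⁻¹ ∈ P
  · obtain ⟨p, hp, hp', hgap⟩ := hgap
    obtain ⟨u, hup, hu, hu0⟩ := exists_int_of_cone htotP hmax hp hp' hgap
    refine ⟨translationAction u hu, fun g => u g, fun g a => ?_, fun a b hab => ?_,
      fun g hg => ?_, fun x => ⟨p, ?_⟩, Or.inr fun g => ⟨u g, fun x => rfl⟩⟩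
    · simp only [translationAction_apply, hu]; push_cast; ring
    · have h1 := hu0 _ (hP₀ hab)
      have h2 := hu a (a⁻¹ * b)
      rw [mul_inv_cancel_left] at h2
      rw [Int.cast_le]; omega
    · ext x
      have := hg 1
      rw [Int.cast_inj, hu] at this
      rw [translationAction_apply, show u g = 0 by omega]; simp
    · rw [translationAction_apply, hup]; simp
  · push Not at hgap
    obtain ⟨u, hd, hu⟩ := exists_denseRange_of_cone htotP hP fun p hp hp' => by
      obtain ⟨q, h1, h2, h3, h4⟩ := hgap p hp hp'
      exact ⟨q, h1, h2, h3, h4⟩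
    obtain ⟨j, hj⟩ := exists_action_of_denseRange hd fun g a b hab => by
      rw [hu] at hab ⊢
      rwa [show (g * a)⁻¹ * (g * b) = a⁻¹ * b by group]
    have hmin : IsMinimal j := by
      intro x
      by_contra hx
      set O := Set.range fun g : G => j g x with hO
      have hOinv : ∀ (g : G), ∀ o ∈ O, j g o ∈ O := by
        rintro g _ ⟨h, rfl⟩
        exact ⟨g * h, by simp⟩
      have hOu : ∀ a, u a ∉ O := by
        intro a ha
        refine hx (hd.mono ?_)
        rintro _ ⟨b, rfl⟩
        have := hOinv (b * a⁻¹) _ ha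
        rwa [hj, inv_mul_cancel_right] at this
      have hcontra : ∀ a : G, ∀ o ∈ O, u a ≠ o := fun a o ho h => hOu a (h ▸ ho)
      -- No orbit point separates `u g` from a larger `u 1`. This submonoid contains `P`, strictly
      -- because the orbit misses an open interval, so maximality makes it `⊤`; yet `x` itself
      -- separates some `u d` from some `u c`.
      let Q : Submonoid G :=
        { carrier := {g | ∀ o ∈ O, u g < o → ¬ o < u 1}
          one_mem' := fun o _ h h' => lt_asymm h h'
          mul_mem' := by
            intro g h hg hh o ho h1 h2
            rcases lt_or_gt_of_ne (hcontra g o ho) with h3 | h3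
            · exact hg o ho h3 h2
            · refine hh (j g⁻¹ o) (hOinv _ _ ho) ?_ ?_
              · have := (j g⁻¹).strictMono h1
                rwa [hj, inv_mul_cancel_left] at this
              · have := (j g⁻¹).strictMono h3
                rwa [hj, inv_mul_cancel] at this }
      have hPQ : P ≤ Q := by
        intro g hg o ho h1 h2
        have : u 1 ≤ u g := by rw [hu]; simpa using hg
        linarith
      have hQtop : Q = ⊤ := by
        by_contra hQ
        have hQP := hmax Q hPQ hQ
        obtain ⟨y, hy⟩ := not_forall.1 hx
        obtain ⟨p, q, ⟨hpy, hyq⟩, hpq⟩ :=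
          mem_nhds_iff_exists_Ioo_subset.1 (isClosed_closure.isOpen_compl.mem_nhds hy)
        obtain ⟨_, ⟨a, rfl⟩, ha⟩ := hd.exists_between (hpy.trans hyq)
        obtain ⟨_, ⟨b, rfl⟩, hb⟩ := hd.exists_between ha.2
        have hmem : b⁻¹ * a ∈ Q := by
          intro o ho h1 h2
          have h1 := (j b).strictMono h1
          have h2 := (j b).strictMono h2
          rw [hj, mul_inv_cancel_left] at h1
          rw [hj, mul_one] at h2
          exact hpq ⟨ha.1.trans h1, h2.trans hb.2⟩ (subset_closure (hOinv b o ho))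
        rw [hQP, ← hu] at hmem
        linarith [hb.1]
      obtain ⟨_, ⟨c, rfl⟩, hc⟩ := hd.exists_gt x
      obtain ⟨_, ⟨d, rfl⟩, hd'⟩ := hd.exists_lt x
      have hmem : c⁻¹ * d ∈ Q := hQtop ▸ Submonoid.mem_top _
      refine hmem (j c⁻¹ x) ⟨c⁻¹, rfl⟩ ?_ ?_
      · rw [← hj]; exact (j c⁻¹).strictMono hd'
      · have := (j c⁻¹).strictMono hc
        rwa [hj, inv_mul_cancel] at this
    refine ⟨j, u, hj, fun a b hab => (hu a b).2 (hP₀ hab), fun g hg => ?_,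
      hmin.isIrreducible, Or.inl hmin⟩
    ext x
    exact congrFun (hd.equalizer (j g).continuous continuous_id (by
      funext a; simp [hj, hg])) x

end LineAction

/-! ### Intervals, laminations and their closures. -/

namespace LineAction
variable {G : Type*} [Group G]

theorem action_mul (φ : G →* HomeoPlus) (g h : G) (x : ℝ) : φ (g * h) x = φ g (φ h x) := by
  rw [map_mul, RelIso.mul_apply]

theorem action_one (φ : G →* HomeoPlus) (x : ℝ) : φ 1 x = x := by
  rw [map_one, RelIso.coe_one, id]

theorem action_inv_self (φ : G →* HomeoPlus) (g : G) (x : ℝ) : φ g⁻¹ (φ g x) = x := by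
  rw [← action_mul, inv_mul_cancel, action_one]

theorem action_self_inv (φ : G →* HomeoPlus) (g : G) (x : ℝ) : φ g (φ g⁻¹ x) = x := by
  rw [← action_mul, mul_inv_cancel, action_one]

theorem lt_action_inv (φ : G →* HomeoPlus) (g : G) {x y : ℝ} : x < φ g⁻¹ y ↔ φ g x < y := by
  rw [← (φ g).lt_iff_lt, action_self_inv]

theorem action_inv_lt (φ : G →* HomeoPlus) (g : G) {x y : ℝ} : φ g⁻¹ x < y ↔ x < φ g y := by
  rw [← (φ g).lt_iff_lt, action_self_inv]

namespace OpenInterval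

/-- Inclusion of intervals, in terms of the endpoints. -/
def Sub (I J : OpenInterval) : Prop := J.1.1 ≤ I.1.1 ∧ I.1.2 ≤ J.1.2

end OpenInterval

infix:50 " ⊑ " => OpenInterval.Sub

namespace OpenInterval

theorem toSet_subset_iff {I J : OpenInterval} : I.toSet ⊆ J.toSet ↔ I ⊑ J :=
  Set.Ioo_subset_Ioo_iff I.2

theorem Sub.refl (I : OpenInterval) : I ⊑ I := ⟨le_rfl, le_rfl⟩

theorem Sub.trans {I J K : OpenInterval} (h : I ⊑ J) (h' : J ⊑ K) : I ⊑ K :=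
  ⟨h'.1.trans h.1, h.2.trans h'.2⟩

theorem Sub.antisymm {I J : OpenInterval} (h : I ⊑ J) (h' : J ⊑ I) : I = J :=
  Subtype.ext (Prod.ext (le_antisymm h'.1 h.1) (le_antisymm h.2 h'.2))

@[simp] theorem map_fst (f : HomeoPlus) (I : OpenInterval) : (I.map f).1.1 = f I.1.1 := rfl

@[simp] theorem map_snd (f : HomeoPlus) (I : OpenInterval) : (I.map f).1.2 = f I.1.2 := rfl

theorem map_comp (f g : HomeoPlus) (I : OpenInterval) : I.map (f * g) = (I.map g).map f := rfl

theorem map_refl (I : OpenInterval) : I.map 1 = I := rfl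

theorem map_hom_one (φ : G →* HomeoPlus) (I : OpenInterval) : I.map (φ 1) = I := by
  rw [map_one, map_refl]

theorem map_sub_map (f : HomeoPlus) {I J : OpenInterval} : I.map f ⊑ J.map f ↔ I ⊑ J := by
  simp [Sub]

theorem map_hom_mul (φ : G →* HomeoPlus) (g h : G) (I : OpenInterval) :
    I.map (φ (g * h)) = (I.map (φ h)).map (φ g) := by
  rw [map_mul, map_comp]

theorem map_inv_map (φ : G →* HomeoPlus) (g : G) (I : OpenInterval) :
    (I.map (φ g)).map (φ g⁻¹) = I := by
  rw [← map_hom_mul, inv_mul_cancel, map_hom_one]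

theorem map_map_inv (φ : G →* HomeoPlus) (g : G) (I : OpenInterval) :
    (I.map (φ g⁻¹)).map (φ g) = I := by
  rw [← map_hom_mul, mul_inv_cancel, map_hom_one]

theorem map_sub_iff (φ : G →* HomeoPlus) (g : G) {I J : OpenInterval} :
    I.map (φ g) ⊑ J ↔ I ⊑ J.map (φ g⁻¹) := by
  rw [← map_sub_map (φ g⁻¹), map_inv_map]

theorem continuous_map (f : HomeoPlus) : Continuous (OpenInterval.map f) :=
  Continuous.subtype_mk
    ((f.continuous.comp (continuous_fst.comp continuous_subtype_val)).prodMk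
      (f.continuous.comp (continuous_snd.comp continuous_subtype_val))) _

end OpenInterval

open OpenInterval

/-- Two intervals are nested or disjoint in both orders if neither crosses the other from the
left. -/
theorem isPrelamination_iff {L : Set OpenInterval} :
    IsPrelamination L ↔
      ∀ I ∈ L, ∀ J ∈ L, I.1.1 < J.1.1 → J.1.1 < I.1.2 → I.1.2 < J.1.2 → False := by
  constructor
  · intro h I hI J hJ h1 h2 h3
    rcases h I hI J hJ with h | h | h
    · exact absurd (toSet_subset_iff.1 h).1 (not_le.2 h1)
    · exact absurd (toSet_subset_iff.1 h).2 (not_le.2 h3)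
    · obtain ⟨y, hy⟩ := exists_between h2
      exact Set.disjoint_left.1 h ⟨h1.trans hy.1, hy.2⟩ ⟨hy.1, hy.2.trans h3⟩
  · intro h I hI J hJ
    rw [toSet_subset_iff, toSet_subset_iff]
    by_cases hd : Disjoint I.toSet J.toSet
    · exact Or.inr (Or.inr hd)
    · obtain ⟨x, hx, hx'⟩ := Set.not_disjoint_iff.1 hd
      have a := hx.1.trans hx'.2
      have b := hx'.1.trans hx.2
      rcases lt_or_ge I.1.1 J.1.1 with h1 | h1
      · exact Or.inr (Or.inl ⟨h1.le, not_lt.1 fun h3 => h I hI J hJ h1 b h3⟩)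
      · rcases h1.eq_or_lt with h1 | h1
        · rcases le_total I.1.2 J.1.2 with h2 | h2
          · exact Or.inl ⟨h1.le, h2⟩
          · exact Or.inr (Or.inl ⟨h1.ge, h2⟩)
        · exact Or.inl ⟨h1.le, not_lt.1 fun h3 => h J hJ I hI h1 a h3⟩

theorem IsPrelamination.nested {L : Set OpenInterval} (hL : IsPrelamination L) {I J : OpenInterval}
    (hI : I ∈ L) (hJ : J ∈ L) (h1 : I.1.1 < J.1.2) (h2 : J.1.1 < I.1.2) : I ⊑ J ∨ J ⊑ I := by
  rcases hL I hI J hJ with h | h | h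
  · exact Or.inl (toSet_subset_iff.1 h)
  · exact Or.inr (toSet_subset_iff.1 h)
  · obtain ⟨x, hx⟩ := exists_between
      (max_lt (lt_min I.2 h1) (lt_min h2 J.2) : max I.1.1 J.1.1 < min I.1.2 J.1.2)
    rw [max_lt_iff, lt_min_iff] at hx
    exact absurd ⟨hx.1.2, hx.2.2⟩ (Set.disjoint_left.1 h ⟨hx.1.1, hx.2.1⟩)

theorem IsPrelamination.nested_of_sub {L : Set OpenInterval} (hL : IsPrelamination L)
    {I J K : OpenInterval} (hI : I ∈ L) (hJ : J ∈ L) (h1 : K ⊑ I) (h2 : K ⊑ J) :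
    I ⊑ J ∨ J ⊑ I :=
  hL.nested hI hJ (h1.1.trans_lt (K.2.trans_le h2.2)) (h2.1.trans_lt (K.2.trans_le h1.2))

theorem continuous_left : Continuous fun I : OpenInterval => I.1.1 :=
  continuous_fst.comp continuous_subtype_val

theorem continuous_right : Continuous fun I : OpenInterval => I.1.2 :=
  continuous_snd.comp continuous_subtype_val

/-- Crossing is an open condition on pairs, so a crossing in the closure would be approximated by
one in `L`. -/
theorem IsPrelamination.closure {L : Set OpenInterval} (hL : IsPrelamination L) :
    IsPrelamination (closure L) := by
  rw [isPrelamination_iff] at hL ⊢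
  intro I hI J hJ h1 h2 h3
  have hmem : (I, J) ∈ _root_.closure (L ×ˢ L) := by
    rw [closure_prod_eq]; exact ⟨hI, hJ⟩
  let U : Set (OpenInterval × OpenInterval) :=
    {p | p.1.1.1 < p.2.1.1 ∧ p.2.1.1 < p.1.1.2 ∧ p.1.1.2 < p.2.1.2}
  have c1 := continuous_left.comp (continuous_fst (X := OpenInterval) (Y := OpenInterval))
  have c2 := continuous_left.comp (continuous_snd (X := OpenInterval) (Y := OpenInterval))
  have c3 := continuous_right.comp (continuous_fst (X := OpenInterval) (Y := OpenInterval))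
  have c4 := continuous_right.comp (continuous_snd (X := OpenInterval) (Y := OpenInterval))
  have hU : IsOpen U := (isOpen_lt c1 c2).inter ((isOpen_lt c2 c3).inter (isOpen_lt c3 c4))
  obtain ⟨⟨I', J'⟩, ⟨h1', h2', h3'⟩, hI', hJ'⟩ := mem_closure_iff.1 hmem U hU ⟨h1, h2, h3⟩
  exact hL I' hI' J' hJ' h1' h2' h3'

theorem IsInvariant.closure {φ : G →* HomeoPlus} {L : Set OpenInterval} (hL : IsInvariant φ L) :
    IsInvariant φ (closure L) := fun g _ hI =>
  map_mem_closure (continuous_map (φ g)) hI fun J hJ => hL g J hJ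

/-- An element strictly enlarging an interval of the closure of an invariant prelamination strictly
enlarges an interval of the prelamination. -/
theorem exists_enlarged_of_mem_closure {φ : G →* HomeoPlus} {L : Set OpenInterval}
    (hL : IsPrelamination L) (hinv : IsInvariant φ L) {J : OpenInterval} (hJ : J ∈ closure L)
    {g : G} (h : J ⊑ J.map (φ g)) (hne : J.map (φ g) ≠ J) :
    ∃ I ∈ L, I ⊑ I.map (φ g) ∧ I.map (φ g) ≠ I := by
  have hc1 := (φ g).continuous.comp continuous_left
  have hc2 := (φ g).continuous.comp continuous_right
  by_cases h2 : J.1.2 < φ g J.1.2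
  · have hU : IsOpen {I : OpenInterval | I.1.2 < φ g I.1.2 ∧ φ g I.1.1 < I.1.2} :=
      (isOpen_lt continuous_right hc2).inter (isOpen_lt hc1 continuous_right)
    obtain ⟨I, ⟨h3, h4⟩, hI⟩ := mem_closure_iff.1 hJ _ hU ⟨h2, h.1.trans_lt J.2⟩
    refine ⟨I, hI, ?_, fun he => ?_⟩
    · exact (hL.nested hI (hinv g I hI) (I.2.trans h3) h4).resolve_right
        fun hs => absurd hs.2 (not_le.2 h3)
    · have := congrArg (fun K : OpenInterval => K.1.2) he
      exact h3.ne' this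
  · have h1 : φ g J.1.1 < J.1.1 := by
      refine lt_of_le_of_ne h.1 fun he => hne ?_
      exact Subtype.ext (Prod.ext he (le_antisymm (not_lt.1 h2) h.2))
    have hU : IsOpen {I : OpenInterval | φ g I.1.1 < I.1.1 ∧ I.1.1 < φ g I.1.2} :=
      (isOpen_lt hc1 continuous_left).inter (isOpen_lt continuous_left hc2)
    obtain ⟨I, ⟨h3, h4⟩, hI⟩ := mem_closure_iff.1 hJ _ hU ⟨h1, J.2.trans_le h.2⟩
    refine ⟨I, hI, ?_, fun he => ?_⟩
    · exact (hL.nested hI (hinv g I hI) h4 (h3.trans I.2)).resolve_right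
        fun hs => absurd hs.1 (not_le.2 h3)
    · have := congrArg (fun K : OpenInterval => K.1.1) he
      exact h3.ne this

theorem IsMinimal.exists_mem {φ : G →* HomeoPlus} (hφ : IsMinimal φ) (x : ℝ) {a b : ℝ}
    (hab : a < b) : ∃ g : G, a < φ g x ∧ φ g x < b := by
  obtain ⟨_, ⟨g, rfl⟩, hg⟩ := (hφ x).exists_between hab
  exact ⟨g, hg⟩

theorem IsMinimal.isCovering {φ : G →* HomeoPlus} (hφ : IsMinimal φ) {L : Set OpenInterval}
    (hne : L.Nonempty) (hinv : IsInvariant φ L) : IsCovering L := by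
  intro x
  obtain ⟨I, hI⟩ := hne
  obtain ⟨g, h1, h2⟩ := hφ.exists_mem x I.2
  exact ⟨I.map (φ g⁻¹), hinv _ _ hI, (action_inv_lt φ g).2 h1, (lt_action_inv φ g).2 h2⟩

/-- A covering prelamination contains neighbourhoods of all compact intervals. -/
theorem IsCovering.exists_lt {L : Set OpenInterval} (hcov : IsCovering L)
    (hL : IsPrelamination L) (x y : ℝ) : ∃ I ∈ L, I.1.1 < x ∧ y < I.1.2 := by
  by_contra! hno
  -- Right ends of the members around `x`. A member around the supremum would either cross one of
  -- them or contain `x` and reach further.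
  let A : Set ℝ := {d | ∃ I ∈ L, x ∈ I.toSet ∧ I.1.2 = d}
  obtain ⟨I₀, hI₀, hx₀⟩ := hcov x
  have hne : A.Nonempty := ⟨_, I₀, hI₀, hx₀, rfl⟩
  have hbdd : BddAbove A := ⟨y, by
    rintro _ ⟨I, hI, hxI, rfl⟩
    exact hno I hI hxI.1⟩
  obtain ⟨K, hK, hsK⟩ := hcov (sSup A)
  obtain ⟨_, ⟨I, hI, hxI, rfl⟩, hd⟩ := exists_lt_of_lt_csSup hne hsK.1
  have hle : I.1.2 ≤ sSup A := le_csSup hbdd ⟨I, hI, hxI, rfl⟩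
  have hlt : I.1.2 < K.1.2 := hle.trans_lt hsK.2
  have hKI : K.1.1 ≤ I.1.1 := not_lt.1 fun h => isPrelamination_iff.1 hL I hI K hK h hd hlt
  have : K.1.2 ≤ sSup A :=
    le_csSup hbdd ⟨K, hK, ⟨hKI.trans_lt hxI.1, hxI.2.trans hlt⟩, rfl⟩
  exact absurd hsK.2 (not_lt.2 this)

section Orbit

variable {φ : G →* HomeoPlus} {L : Set OpenInterval}

/-- The orbit of one interval is already an invariant prelamination, so by minimality it covers the
line. -/
theorem IsMinimal.exists_map_gt (hφ : IsMinimal φ) (hL : IsPrelamination L)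
    (hinv : IsInvariant φ L) {I : OpenInterval} (hI : I ∈ L) (x y : ℝ) :
    ∃ g : G, φ g I.1.1 < x ∧ y < φ g I.1.2 := by
  let O : Set OpenInterval := Set.range fun g : G => I.map (φ g)
  have hOL : O ⊆ L := by
    rintro _ ⟨g, rfl⟩
    exact hinv g I hI
  have hO : IsPrelamination O := fun J hJ K hK => hL J (hOL hJ) K (hOL hK)
  have hOinv : IsInvariant φ O := by
    rintro g _ ⟨h, rfl⟩
    exact ⟨g * h, by simp only [map_hom_mul]⟩
  obtain ⟨_, ⟨g, rfl⟩, hg⟩ := (hφ.isCovering (Set.range_nonempty _) hOinv).exists_lt hO x y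
  exact ⟨g, hg⟩

/-- Send the left end into `J`, then by another element the right end into `J` beyond that point. If
both translates overflow `J`, they cross. -/
theorem IsMinimal.exists_map_sub (hφ : IsMinimal φ) (hL : IsPrelamination L)
    (hinv : IsInvariant φ L) {I : OpenInterval} (hI : I ∈ L) (J : OpenInterval) :
    ∃ g : G, I.map (φ g) ⊑ J := by
  obtain ⟨g, hg1, hg2⟩ := hφ.exists_mem I.1.1 J.2
  obtain ⟨h, hh1, hh2⟩ := hφ.exists_mem I.1.2 hg2
  by_cases h1 : φ g I.1.2 ≤ J.1.2
  · exact ⟨g, hg1.le, h1⟩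
  by_cases h2 : J.1.1 ≤ φ h I.1.1
  · exact ⟨h, h2, hh2.le⟩
  push Not at h1 h2
  exact (isPrelamination_iff.1 hL _ (hinv h I hI) _ (hinv g I hI) (h2.trans hg1) hh1
    (hh2.trans h1)).elim

end Orbit

/-! ### Elliptic subgroups and the elliptic-exhausting dichotomy. -/

/-- No element of `N` strictly enlarges an interval of `L`. -/
def IsElliptic (φ : G →* HomeoPlus) (N : Subgroup G) (L : Set OpenInterval) : Prop :=
  ∀ n ∈ N, ∀ I ∈ L, I ⊑ I.map (φ n) → I.map (φ n) = I

theorem IsElliptic.eq_of_sub {φ : G →* HomeoPlus} {N : Subgroup G} {L : Set OpenInterval}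
    (h : IsElliptic φ N L) {n : G} (hn : n ∈ N) {I : OpenInterval} (hI : I ∈ L)
    (hs : I.map (φ n) ⊑ I) : I.map (φ n) = I := by
  have := h n⁻¹ (N.inv_mem hn) I hI ((map_sub_iff φ n).1 hs)
  conv_lhs => rw [← this]
  rw [map_map_inv]

theorem IsElliptic.closure {φ : G →* HomeoPlus} {N : Subgroup G} {L : Set OpenInterval}
    (h : IsElliptic φ N L) (hL : IsPrelamination L) (hinv : IsInvariant φ L) :
    IsElliptic φ N (closure L) := by
  intro n hn I hI hs
  by_contra hne
  obtain ⟨J, hJ, h1, h2⟩ := exists_enlarged_of_mem_closure hL hinv hI hs hne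
  exact h2 (h n hn J hJ h1)

/-- A non-empty invariant lamination none of whose intervals is strictly enlarged by `N`. -/
structure IsEllipticLamination (φ : G →* HomeoPlus) (N : Subgroup G) (L : Set OpenInterval) :
    Prop where
  nonempty : L.Nonempty
  prelamination : IsPrelamination L
  closed : IsClosed L
  invariant : IsInvariant φ L
  elliptic : IsElliptic φ N L

section Dichotomy

variable {φ : G →* HomeoPlus} {L : Set OpenInterval}

/-- If the translates of `J` by `B` which contain `J` do not exhaust the line, then their union is
an interval of the lamination that `B` does not enlarge. -/
theorem exists_elliptic_or_exhausting (hcov : IsCovering L) (hL : IsPrelamination L)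
    (hclosed : IsClosed L) (hinv : IsInvariant φ L) (B : Subgroup G) {J : OpenInterval}
    (hJ : J ∈ L) :
    (∃ K ∈ L, ∀ b ∈ B, K ⊑ K.map (φ b) → K.map (φ b) = K) ∨
      ∀ x y : ℝ, ∃ b ∈ B, φ b J.1.1 < x ∧ y < φ b J.1.2 := by
  -- The translates containing `J` are pairwise nested, hence directed.
  let S : Set G := {b | b ∈ B ∧ J ⊑ J.map (φ b)}
  have h1S : (1 : G) ∈ S := ⟨B.one_mem, by rw [map_hom_one]; exact Sub.refl J⟩
  have hdir : ∀ a ∈ S, ∀ b ∈ S, ∃ c ∈ S, J.map (φ a) ⊑ J.map (φ c) ∧ J.map (φ b) ⊑ J.map (φ c) := by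
    intro a ha b hb
    rcases hL.nested_of_sub (hinv a J hJ) (hinv b J hJ) ha.2 hb.2 with h | h
    · exact ⟨b, hb, h, Sub.refl _⟩
    · exact ⟨a, ha, Sub.refl _, h⟩
  let A₁ : Set ℝ := (fun b => φ b J.1.1) '' S
  let A₂ : Set ℝ := (fun b => φ b J.1.2) '' S
  have hne₁ : A₁.Nonempty := ⟨_, 1, h1S, rfl⟩
  have hne₂ : A₂.Nonempty := ⟨_, 1, h1S, rfl⟩
  have hcross := isPrelamination_iff.1 hL
  have hJ₁ : J.1.1 ∈ A₁ := ⟨1, h1S, by simp⟩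
  have hJ₂ : J.1.2 ∈ A₂ := ⟨1, h1S, by simp⟩
  by_cases hb₁ : BddBelow A₁ <;> by_cases hb₂ : BddAbove A₂
  · left
    have hu : sInf A₁ ≤ J.1.1 := csInf_le hb₁ hJ₁
    have hv : J.1.2 ≤ sSup A₂ := le_csSup hb₂ hJ₂
    have happrox : ∀ x y, sInf A₁ < x → y < sSup A₂ →
        ∃ b ∈ S, φ b J.1.1 < x ∧ y < φ b J.1.2 := by
      intro x y hx hy
      obtain ⟨_, ⟨a, ha, rfl⟩, ha'⟩ := exists_lt_of_csInf_lt hne₁ hx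
      obtain ⟨_, ⟨b, hb, rfl⟩, hb'⟩ := exists_lt_of_lt_csSup hne₂ hy
      obtain ⟨c, hc, hac, hbc⟩ := hdir a ha b hb
      exact ⟨c, hc, hac.1.trans_lt ha', lt_of_lt_of_le hb' hbc.2⟩
    let K : OpenInterval := ⟨(sInf A₁, sSup A₂), hu.trans_lt (J.2.trans_le hv)⟩
    have hK₁ : K.1.1 = sInf A₁ := rfl
    have hK₂ : K.1.2 = sSup A₂ := rfl
    have hKle : ∀ b ∈ S, J.map (φ b) ⊑ K := fun b hb =>
      ⟨csInf_le hb₁ ⟨b, hb, rfl⟩, le_csSup hb₂ ⟨b, hb, rfl⟩⟩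
    have hKL : K ∈ L := by
      rw [← hclosed.closure_eq, Metric.mem_closure_iff]
      intro ε hε
      obtain ⟨b, hb, h1, h2⟩ := happrox (K.1.1 + ε) (K.1.2 - ε) (by linarith) (by linarith)
      refine ⟨J.map (φ b), hinv b J hJ, ?_⟩
      have h3 := hKle b hb
      rw [Subtype.dist_eq, Prod.dist_eq, max_lt_iff, Real.dist_eq, Real.dist_eq, abs_lt, abs_lt]
      have h4 := h3.1
      have h5 := h3.2
      simp only [map_fst, map_snd] at h4 h5 ⊢
      refine ⟨⟨?_, ?_⟩, ?_, ?_⟩ <;> linarith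
    -- If `c` enlarged `K` strictly, some `c * b` would send `J` to an interval overlapping `J` and
    -- sticking out of `K`. It would then contain `J`, so `c * b` would be in `S` and its translate
    -- inside `K`.
    refine ⟨K, hKL, fun c hc hs => Sub.antisymm ?_ hs⟩
    have hs₁ : φ c K.1.1 ≤ K.1.1 := hs.1
    have hs₂ : K.1.2 ≤ φ c K.1.2 := hs.2
    have hmem : ∀ b ∈ S, φ (c * b) J.1.1 < J.1.2 → J.1.1 < φ (c * b) J.1.2 →
        ¬ J.map (φ (c * b)) ⊑ J → J.map (φ (c * b)) ⊑ K := by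
      intro b hb h1 h2 h3
      exact hKle _ ⟨B.mul_mem hc hb.1,
        (hL.nested (hinv _ J hJ) hJ h1 h2).resolve_left h3⟩
    constructor
    · by_contra! h
      rw [map_fst] at h
      obtain ⟨b, hb, h1, h2⟩ := happrox (φ c⁻¹ K.1.1) (φ c⁻¹ J.1.1) ((lt_action_inv φ c).2 h)
        ((action_inv_lt φ c).2 ((J.2.trans_le hv).trans_le hs₂))
      rw [lt_action_inv, ← action_mul] at h1
      rw [action_inv_lt, ← action_mul] at h2
      have h3 : φ (c * b) J.1.1 < J.1.1 := h1.trans_le hu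
      have := hmem b hb (h3.trans J.2) h2 fun h4 => absurd h4.1 (not_le.2 h3)
      exact absurd this.1 (not_le.2 h1)
    · by_contra! h
      rw [map_snd] at h
      obtain ⟨b, hb, h1, h2⟩ := happrox (φ c⁻¹ J.1.2) (φ c⁻¹ K.1.2)
        ((lt_action_inv φ c).2 (hs₁.trans_lt (hu.trans_lt J.2))) ((action_inv_lt φ c).2 h)
      rw [lt_action_inv, ← action_mul] at h1
      rw [action_inv_lt, ← action_mul] at h2
      have h3 : J.1.2 < φ (c * b) J.1.2 := lt_of_le_of_lt hv h2
      have := hmem b hb h1 (J.2.trans h3) fun h4 => absurd h4.2 (not_le.2 h3)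
      exact absurd this.2 (not_le.2 h2)
  -- If only one side is bounded, a member around the finite end is crossed by a large translate.
  · obtain ⟨K, hK, hK1, hK2⟩ := hcov (sInf A₁)
    obtain ⟨_, ⟨a, ha, rfl⟩, ha'⟩ := exists_lt_of_csInf_lt hne₁ hK2
    obtain ⟨_, ⟨b, hb, rfl⟩, hb'⟩ := not_bddAbove_iff.1 hb₂ K.1.2
    obtain ⟨c, hc, hac, hbc⟩ := hdir a ha b hb
    exact (hcross K hK _ (hinv c J hJ) (hK1.trans_le (csInf_le hb₁ ⟨c, hc, rfl⟩))
      (hac.1.trans_lt ha') (lt_of_lt_of_le hb' hbc.2)).elim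
  · obtain ⟨K, hK, hK1, hK2⟩ := hcov (sSup A₂)
    obtain ⟨_, ⟨a, ha, rfl⟩, ha'⟩ := exists_lt_of_lt_csSup hne₂ hK1
    obtain ⟨_, ⟨b, hb, rfl⟩, hb'⟩ := not_bddBelow_iff.1 hb₁ K.1.1
    obtain ⟨c, hc, hac, hbc⟩ := hdir a ha b hb
    exact (hcross _ (hinv c J hJ) K hK (hbc.1.trans_lt hb') (lt_of_lt_of_le ha' hac.2)
      (lt_of_le_of_lt (le_csSup hb₂ ⟨c, hc, rfl⟩) hK2)).elim
  · right
    intro x y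
    obtain ⟨_, ⟨a, ha, rfl⟩, ha'⟩ := not_bddBelow_iff.1 hb₁ x
    obtain ⟨_, ⟨b, hb, rfl⟩, hb'⟩ := not_bddAbove_iff.1 hb₂ y
    obtain ⟨c, hc, hac, hbc⟩ := hdir a ha b hb
    exact ⟨c, hc.1, hac.1.trans_lt ha', lt_of_lt_of_le hb' hbc.2⟩

end Dichotomy

end LineAction

/-! ### Climbing the derived series to a lamination totally ordered modulo `N`. -/

namespace LineAction
variable {G : Type*} [Group G]
open OpenInterval

theorem commutator_mem {H K N : Subgroup G} (h : ⁅H, K⁆ ≤ N) {a b : G} (ha : a ∈ H) (hb : b ∈ K) :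
    a * b * a⁻¹ * b⁻¹ ∈ N :=
  h (Subgroup.commutator_mem_commutator ha hb)

theorem commutator_le_iff_map_le {X Y Z : Subgroup G} [Z.Normal] :
    ⁅X, Y⁆ ≤ Z ↔ X.map (QuotientGroup.mk' Z) ≤
      Subgroup.centralizer (Y.map (QuotientGroup.mk' Z) : Subgroup (G ⧸ Z)) := by
  rw [← Subgroup.commutator_eq_bot_iff_le_centralizer, ← Subgroup.map_commutator,
    Subgroup.map_eq_bot_iff, QuotientGroup.ker_mk']

theorem sup_commutator_le {X X' Y Z : Subgroup G} [Z.Normal] (h : ⁅X, Y⁆ ≤ Z) (h' : ⁅X', Y⁆ ≤ Z) :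
    ⁅X ⊔ X', Y⁆ ≤ Z := by
  rw [commutator_le_iff_map_le] at *
  rw [Subgroup.map_sup]
  exact sup_le h h'

theorem commutator_sup_sup_le {N D D' : Subgroup G} [N.Normal] [D.Normal] [D'.Normal]
    (h : ⁅D, D⁆ ≤ D') : ⁅N ⊔ D, N ⊔ D⁆ ≤ N ⊔ D' := by
  refine sup_commutator_le ((Subgroup.commutator_le_left _ _).trans le_sup_left) ?_
  rw [Subgroup.commutator_comm]
  exact sup_commutator_le ((Subgroup.commutator_le_left _ _).trans le_sup_left)
    (h.trans le_sup_right)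

/-- In a forest order, two elements with a common upper bound which is exceeded by images of both
under commuting automorphisms are comparable. -/
theorem comparable_of_commute {X : Type*} {r : X → X → Prop} (hrefl : ∀ x, r x x)
    (htrans : ∀ x y z, r x y → r y z → r x z)
    (hforest : ∀ x y z, r x y → r x z → r y z ∨ r z y) {f g : X → X}
    (hf : ∀ x y, r (f x) (f y) ↔ r x y) (hg : ∀ x y, r (g x) (g y) ↔ r x y)
    (hfg : ∀ x, r (f (g x)) (g (f x))) (hgf : ∀ x, r (g (f x)) (f (g x))) {x y z : X}
    (hxz : r x z) (hyz : r y z) (hzx : r z (f x)) (hzy : r z (g y)) (hnx : ¬ r (f x) z) :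
    r x y ∨ r y x := by
  -- It suffices to treat the case where one map is dominated at `z` by an iterate of the other.
  suffices H : ∀ {f g : X → X} (_ : ∀ x y, r (f x) (f y) ↔ r x y)
      (_ : ∀ x y, r (g x) (g y) ↔ r x y) (_ : ∀ x, r (f (g x)) (g (f x))) {x y : X}
      (_ : r x z) (_ : r y z) (_ : r z (f x)) (_ : r z (g y)) (n : ℕ) (_ : r (g z) (f^[n + 1] z)),
      r x y ∨ r y x by
    have hz1 : r z (f z) := htrans _ _ _ hzx ((hf _ _).2 hxz)
    have hz2 : r z (f (f z)) := htrans _ _ _ hz1 ((hf _ _).2 hz1)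
    have hz3 : r z (g z) := htrans _ _ _ hzy ((hg _ _).2 hyz)
    rcases hforest _ _ _ hz2 hz3 with h1 | h1
    · rcases hforest _ _ _ hz3 hz1 with h2 | h2
      · exact absurd (htrans _ _ _ ((hf _ _).2 hxz) ((hf _ _).1 (htrans _ _ _ h1 h2))) hnx
      · exact (H hg hf hgf hyz hxz hzy hzx 0 h2).symm
    · exact H hf hg hfg hxz hyz hzx hzy 1 h1
  clear hxz hyz hzx hzy hnx hf hg hfg hgf f g x y
  intro f g hf hg hfg x y hxz hyz hzx hzy n hn
  have hfn : ∀ (n : ℕ) (a b : X), r (f^[n] a) (f^[n] b) ↔ r a b := by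
    intro n
    induction n with
    | zero => intro a b; exact Iff.rfl
    | succ n ih => intro a b; rw [Function.iterate_succ_apply, Function.iterate_succ_apply, ih, hf]
  have hfgn : ∀ (n : ℕ) (a : X), r (f^[n] (g a)) (g (f^[n] a)) := by
    intro n
    induction n with
    | zero => intro a; exact hrefl _
    | succ n ih =>
      intro a
      rw [Function.iterate_succ_apply, Function.iterate_succ_apply]
      exact htrans _ _ _ ((hfn n _ _).2 (hfg a)) (ih (f a))
  have hzn : ∀ n : ℕ, r z (f^[n + 1] x) := by
    intro n
    induction n with
    | zero => exact hzx
    | succ n ih =>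
      rw [Function.iterate_succ_apply']
      exact htrans _ _ _ hzx ((hf _ _).2 (htrans _ _ _ hxz ih))
  -- After applying `g`: `g z` is below `f^[n + 1] z`, hence below `f^[n + 1] (g y)` and `g (f^[n +
  -- 1] y)`. Both iterated points then lie above `z`, so the forest property compares them.
  have h1 : r z (f^[n + 1] y) := by
    rw [← hg]
    exact htrans _ _ _ hn (htrans _ _ _ ((hfn _ _ _).2 hzy) (hfgn _ _))
  rcases hforest _ _ _ (hzn n) h1 with h | h
  · exact Or.inl ((hfn _ _ _).1 h)
  · exact Or.inr ((hfn _ _ _).1 h)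

section Chain

variable {φ : G →* HomeoPlus} {L : Set OpenInterval}

theorem IsEllipticLamination.isCovering {N : Subgroup G} (hL : IsEllipticLamination φ N L)
    (hφ : IsMinimal φ) : IsCovering L :=
  hφ.isCovering hL.nonempty hL.invariant

/-- If `B` is abelian modulo `N` and pushes every interval towards infinity, then any two intervals
are nested up to `N`. -/
theorem IsEllipticLamination.nested_of_exhausting {N B : Subgroup G} [N.Normal]
    (hL : IsEllipticLamination φ N L) (hφ : IsMinimal φ) (hB : ⁅B, B⁆ ≤ N)
    (hex : ∀ J ∈ L, ∀ x y : ℝ, ∃ b ∈ B, φ b J.1.1 < x ∧ y < φ b J.1.2)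
    {I J : OpenInterval} (hI : I ∈ L) (hJ : J ∈ L) :
    (∃ n ∈ N, I.map (φ n) ⊑ J) ∨ ∃ n ∈ N, J.map (φ n) ⊑ I := by
  -- Inclusion up to `N` is a forest preorder on which elements of `B` commute.
  let r : L → L → Prop := fun I J => ∃ n ∈ N, I.1.map (φ n) ⊑ J.1
  let act : G → L → L := fun g I => ⟨I.1.map (φ g), hL.invariant g I.1 I.2⟩
  have hconj : ∀ g : G, ∀ n ∈ N, g * n * g⁻¹ ∈ N := fun g n hn => ‹N.Normal›.conj_mem n hn g
  have hmono : ∀ g x y, r x y → r (act g x) (act g y) := by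
    rintro g x y ⟨n, hn, h⟩
    refine ⟨g * n * g⁻¹, hconj g n hn, ?_⟩
    rw [← map_hom_mul, inv_mul_cancel_right, map_hom_mul, map_sub_map]
    exact h
  have hact : ∀ g x y, r (act g x) (act g y) ↔ r x y := by
    intro g x y
    refine ⟨fun h => ?_, hmono g x y⟩
    have := hmono g⁻¹ _ _ h
    have e : ∀ x, act g⁻¹ (act g x) = x := fun x => Subtype.ext (map_inv_map φ g x.1)
    rwa [e, e] at this
  have hcomm : ∀ b ∈ B, ∀ c ∈ B, ∀ x, r (act b (act c x)) (act c (act b x)) := by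
    intro b hb c hc x
    refine ⟨c * b * c⁻¹ * b⁻¹, commutator_mem hB hc hb, ?_⟩
    simp only [act, ← map_hom_mul]
    rw [show c * b * c⁻¹ * b⁻¹ * (b * c) = c * b by group]
    exact Sub.refl _
  obtain ⟨K, hK, hK1, hK2⟩ := (hL.isCovering hφ).exists_lt hL.prelamination
    (min I.1.1 J.1.1) (max I.1.2 J.1.2)
  rw [lt_min_iff] at hK1
  rw [max_lt_iff] at hK2
  obtain ⟨b, hb, hb1, hb2⟩ := hex I hI K.1.1 K.1.2
  obtain ⟨c, hc, hc1, hc2⟩ := hex J hJ K.1.1 K.1.2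
  have of_sub : ∀ x y : L, x.1 ⊑ y.1 → r x y := fun x y h => ⟨1, N.one_mem, by rwa [map_hom_one]⟩
  refine comparable_of_commute (r := r) (f := act b) (g := act c) (x := ⟨I, hI⟩) (y := ⟨J, hJ⟩)
    (z := ⟨K, hK⟩) (fun x => of_sub x x (Sub.refl _)) ?_ ?_ (hact b) (hact c)
    (hcomm b hb c hc) (hcomm c hc b hb) (of_sub _ _ ⟨hK1.1.le, hK2.1.le⟩)
    (of_sub _ _ ⟨hK1.2.le, hK2.2.le⟩) (of_sub _ _ ⟨hb1.le, hb2.le⟩)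
    (of_sub _ _ ⟨hc1.le, hc2.le⟩) ?_
  · rintro x y z ⟨n, hn, hxy⟩ ⟨m, hm, hyz⟩
    refine ⟨m * n, N.mul_mem hm hn, ?_⟩
    rw [map_hom_mul]
    exact Sub.trans ((map_sub_map (φ m)).2 hxy) hyz
  · rintro x y z ⟨n, hn, hxy⟩ ⟨m, hm, hxz⟩
    have h1 := (map_sub_iff φ n).1 hxy
    have h2 := (map_sub_iff φ m).1 hxz
    rcases hL.prelamination.nested_of_sub (hL.invariant _ _ y.2) (hL.invariant _ _ z.2) h1 h2
      with h | h
    · left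
      refine ⟨m * n⁻¹, N.mul_mem hm (N.inv_mem hn), ?_⟩
      rw [map_hom_mul, map_sub_iff]
      exact h
    · right
      refine ⟨n * m⁻¹, N.mul_mem hn (N.inv_mem hm), ?_⟩
      rw [map_hom_mul, map_sub_iff]
      exact h
  · rintro ⟨n, hn, h⟩
    -- The translate strictly contains `K`; fitting into `K` up to `N` would make an element of `N`
    -- shrink it.
    have hs : K ⊑ I.map (φ b) := ⟨hb1.le, hb2.le⟩
    have h3 : (I.map (φ b)).map (φ n) ⊑ I.map (φ b) := h.trans hs
    have h4 := hL.elliptic.eq_of_sub hn (hL.invariant b I hI) h3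
    change (I.map (φ b)).map (φ n) ⊑ K at h
    rw [h4] at h
    exact absurd h.1 (not_le.2 hb1)

/-- A finitely generated group strictly enlarges some interval of every covering lamination. -/
theorem not_isElliptic_top [Group.FG G] (hφ : IsIrreducible φ) (hcov : IsCovering L)
    (hL : IsPrelamination L) (hinv : IsInvariant φ L) : ¬ IsElliptic φ ⊤ L := by
  intro hell
  obtain ⟨S, hS⟩ := Group.fg_def.1 (inferInstance : Group.FG G)
  have hbd : ∀ T : Finset G, ∃ y : ℝ, 0 ≤ y ∧ ∀ s ∈ T, |φ s 0| ≤ y := by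
    intro T
    refine ⟨∑ s ∈ T, |φ s 0|, Finset.sum_nonneg fun _ _ => abs_nonneg _, fun s hs => ?_⟩
    exact Finset.single_le_sum (f := fun s => |φ s 0|) (fun _ _ => abs_nonneg _) hs
  obtain ⟨y, hy, hSy⟩ := hbd S
  -- `J` contains `0` and its images under the generators, so each generator maps `J` to an
  -- overlapping, hence nested, interval.
  obtain ⟨J, hJ, hJ1, hJ2⟩ := hcov.exists_lt hL (-y) y
  have hfix : ∀ s ∈ S, J.map (φ s) = J := by
    intro s hs
    have h := abs_le.1 (hSy s hs)
    have h1 : φ s J.1.1 < φ s 0 := (φ s).strictMono (by linarith)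
    have h2 : φ s 0 < φ s J.1.2 := (φ s).strictMono (by linarith)
    rcases hL.nested hJ (hinv s J hJ) (by rw [map_snd]; linarith) (by rw [map_fst]; linarith)
      with h | h
    · exact hell s trivial J hJ h
    · exact hell.eq_of_sub trivial hJ h
  have hall : ∀ g : G, J.map (φ g) = J := by
    intro g
    have hg : g ∈ Subgroup.closure (S : Set G) := hS ▸ Subgroup.mem_top g
    induction hg using Subgroup.closure_induction with
    | mem x hx => exact hfix x hx
    | one => exact map_hom_one φ J
    | mul x y _ _ hx hy => rw [map_hom_mul, hy, hx]
    | inv x _ hx =>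
      conv_lhs => rw [← hx]
      exact map_inv_map φ x J
  obtain ⟨g, hg⟩ := hφ J.1.1
  exact hg (congrArg (fun K : OpenInterval => K.1.1) (hall g))

/-- Ellipticity passes to finite index overgroups. -/
theorem IsElliptic.top_of_finiteIndex {N : Subgroup G} [N.FiniteIndex] (h : IsElliptic φ N L) :
    IsElliptic φ ⊤ L := by
  intro g _ I hI hs
  obtain ⟨m, hm, _, hmN⟩ :=
    Subgroup.exists_pow_mem_of_index_ne_zero (H := N) Subgroup.FiniteIndex.index_ne_zero g
  have hpow : ∀ k : ℕ, I.map (φ g) ⊑ I.map (φ (g ^ (k + 1))) := by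
    intro k
    induction k with
    | zero => rw [zero_add, pow_one]; exact Sub.refl _
    | succ k ih =>
      rw [pow_succ' g (k + 1), map_hom_mul, map_sub_map]
      exact hs.trans ih
  obtain ⟨k, rfl⟩ : ∃ k, m = k + 1 := ⟨m - 1, by omega⟩
  have hk := hpow k
  have heq := h _ hmN I hI (hs.trans hk)
  rw [heq] at hk
  exact hk.antisymm hs

/-- Starting from a normal subgroup acting elliptically on a lamination, a finitely generated
virtually solvable group admits a lamination which is totally ordered modulo a normal subgroup. -/
theorem exists_total_lamination [Group.FG G] (hφ : IsMinimal φ) {D : ℕ → Subgroup G}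
    [∀ i, (D i).Normal] [(D 0).FiniteIndex] (hD : ∀ i, ⁅D i, D i⁆ ≤ D (i + 1)) {d : ℕ}
    (hd : D d = ⊥) {N₀ : Subgroup G} [hN₀ : N₀.Normal] (hL : IsEllipticLamination φ N₀ L) :
    ∃ (N : Subgroup G) (L : Set OpenInterval), N.Normal ∧ N₀ ≤ N ∧ IsEllipticLamination φ N L ∧
      (∀ I ∈ L, ∀ J ∈ L, (∃ n ∈ N, I.map (φ n) ⊑ J) ∨ ∃ n ∈ N, J.map (φ n) ⊑ I) ∧
      ∃ I ∈ L, ∃ g : G, I ⊑ I.map (φ g) ∧ I.map (φ g) ≠ I := by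
  have enlarged : ∀ {N : Subgroup G} {L : Set OpenInterval}, IsEllipticLamination φ N L →
      ∃ I ∈ L, ∃ g : G, I ⊑ I.map (φ g) ∧ I.map (φ g) ≠ I := by
    intro N L hL
    by_contra! hno
    exact not_isElliptic_top hφ.isIrreducible (hL.isCovering hφ) hL.prelamination hL.invariant
      fun g _ I hI hs => hno I hI g hs
  by_contra! hno
  -- Under `hno`, ellipticity climbs from `D d = ⊥` to the finite-index term `D 0`.
  have key : ∀ k : ℕ, k ≤ d → ∃ L, IsEllipticLamination φ (N₀ ⊔ D (d - k)) L := by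
    intro k
    induction k with
    | zero =>
      intro _
      rw [tsub_zero, hd, sup_bot_eq]
      exact ⟨L, hL⟩
    | succ k ih =>
      intro hk
      obtain ⟨L', hL'⟩ := ih (by omega)
      set B := N₀ ⊔ D (d - (k + 1)) with hB
      have hDD : ⁅D (d - (k + 1)), D (d - (k + 1))⁆ ≤ D (d - k) := by
        have := hD (d - (k + 1))
        rwa [show d - (k + 1) + 1 = d - k by omega] at this
      have hcomm : ⁅B, B⁆ ≤ N₀ ⊔ D (d - k) := commutator_sup_sup_le hDD
      -- The members not enlarged by `B` form a closed invariant sublamination. If there are none,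
      -- every interval is exhausting and the resulting comparability contradicts `hno`.
      by_cases hne : {K ∈ L' | ∀ b ∈ B, K ⊑ K.map (φ b) → K.map (φ b) = K}.Nonempty
      · have hB' : B.Normal := inferInstance
        have hpre : IsPrelamination {K ∈ L' | ∀ b ∈ B, K ⊑ K.map (φ b) → K.map (φ b) = K} :=
          fun I hI J hJ => hL'.prelamination I hI.1 J hJ.1
        have hell : IsElliptic φ B {K ∈ L' | ∀ b ∈ B, K ⊑ K.map (φ b) → K.map (φ b) = K} :=
          fun n hn I hI => hI.2 n hn
        have hinv : IsInvariant φ {K ∈ L' | ∀ b ∈ B, K ⊑ K.map (φ b) → K.map (φ b) = K} := by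
          refine fun g K hK => ⟨hL'.invariant g K hK.1, fun b hb hs => ?_⟩
          have hb' : g⁻¹ * b * g ∈ B := by
            have := hB'.conj_mem b hb g⁻¹
            rwa [inv_inv] at this
          have e : (K.map (φ g)).map (φ b) = (K.map (φ (g⁻¹ * b * g))).map (φ g) := by
            simp only [← map_hom_mul]
            congr 2
            group
          rw [e, map_sub_map] at hs
          rw [e, hK.2 _ hb' hs]
        refine ⟨_, hne, hpre, isClosed_of_closure_subset fun K hK => ⟨?_, fun b hb =>
          hell.closure hpre hinv b hb K hK⟩, hinv, hell⟩
        exact hL'.closed.closure_subset_iff.2 (fun J hJ => hJ.1) hK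
      · exfalso
        have htot := fun I (hI : I ∈ L') J (hJ : J ∈ L') =>
          hL'.nested_of_exhausting hφ hcomm (fun J hJ =>
            (exists_elliptic_or_exhausting (hL'.isCovering hφ) hL'.prelamination hL'.closed
              hL'.invariant B hJ).resolve_left fun ⟨K, hK, hK'⟩ => hne ⟨K, hK, hK'⟩) hI hJ
        obtain ⟨I, hI, g, h1, h2⟩ := enlarged hL'
        exact h2 (hno _ _ inferInstance le_sup_left hL' htot I hI g h1)
  obtain ⟨L', hL'⟩ := key d le_rfl
  rw [tsub_self] at hL'
  have : (N₀ ⊔ D 0).FiniteIndex := Subgroup.finiteIndex_of_le (le_sup_right : D 0 ≤ N₀ ⊔ D 0)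
  exact not_isElliptic_top hφ.isIrreducible (hL'.isCovering hφ) hL'.prelamination hL'.invariant
    hL'.elliptic.top_of_finiteIndex

end Chain

end LineAction

/-! ### From a totally ordered lamination to a horograding. -/

namespace LineAction
variable {G : Type*} [Group G]
open OpenInterval

section Horograding

variable {φ : G →* HomeoPlus} {L : Set OpenInterval} {N : Subgroup G}

/-- The elements enlarging `I` up to `N`. -/
def enlargingCone (φ : G →* HomeoPlus) (N : Subgroup G) [N.Normal] (I : OpenInterval) :
    Submonoid G where
  carrier := {g | ∃ n ∈ N, I ⊑ I.map (φ (n * g))}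
  one_mem' := ⟨1, N.one_mem, by rw [mul_one, map_hom_one]; exact Sub.refl I⟩
  mul_mem' := by
    rintro g h ⟨n, hn, hg⟩ ⟨m, hm, hh⟩
    refine ⟨n * (g * m * g⁻¹), N.mul_mem hn (‹N.Normal›.conj_mem m hm g), hg.trans ?_⟩
    rw [show n * (g * m * g⁻¹) * (g * h) = n * g * (m * h) by group, map_hom_mul φ (n * g) (m * h),
      map_sub_map]
    exact hh

/-- A lamination which is totally ordered modulo a normal subgroup `N` gives a horograding by an
action of the quotient by `N`. -/
theorem IsEllipticLamination.exists_horograding [Group.FG G] [N.Normal]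
    (hL : IsEllipticLamination φ N L) (hφ : IsMinimal φ)
    (htot : ∀ I ∈ L, ∀ J ∈ L, (∃ n ∈ N, I.map (φ n) ⊑ J) ∨ ∃ n ∈ N, J.map (φ n) ⊑ I)
    {I₀ : OpenInterval} (hI₀ : I₀ ∈ L) {g₀ : G} (hs : I₀ ⊑ I₀.map (φ g₀))
    (hne : I₀.map (φ g₀) ≠ I₀) :
    ∃ j : G →* HomeoPlus, IsHorogradedBy φ j ∧ N ≤ j.ker ∧ (IsMinimal j ∨ IsCyclic j) := by
  have htotP : ∀ g, g ∈ enlargingCone φ N I₀ ∨ g⁻¹ ∈ enlargingCone φ N I₀ := by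
    intro g
    rcases htot I₀ hI₀ _ (hL.invariant g I₀ hI₀) with ⟨n, hn, h⟩ | ⟨n, hn, h⟩
    · refine Or.inl ⟨n⁻¹, N.inv_mem hn, ?_⟩
      rw [map_hom_mul]
      exact (map_sub_iff φ n).1 h
    · refine Or.inr ⟨g⁻¹ * n⁻¹ * g, ?_, ?_⟩
      · have := ‹N.Normal›.conj_mem _ (N.inv_mem hn) g⁻¹
        rwa [inv_inv] at this
      · rw [← map_hom_mul, map_sub_iff, mul_inv_rev] at h
        rwa [show g⁻¹ * n⁻¹ * g * g⁻¹ = g⁻¹ * n⁻¹ by group]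
  -- `g₀⁻¹` shrinks `I₀` strictly; in the cone, it would force an element of `N` to shrink `I₀` at
  -- least as much.
  have hneP : enlargingCone φ N I₀ ≠ ⊤ := by
    intro htop
    have hmem : g₀⁻¹ ∈ enlargingCone φ N I₀ := htop ▸ Submonoid.mem_top _
    obtain ⟨n, hn, h⟩ := hmem
    have h1 : I₀.map (φ n⁻¹) ⊑ I₀.map (φ g₀⁻¹) := by
      rw [map_sub_iff, inv_inv, ← map_hom_mul]; exact h
    have h2 : I₀.map (φ g₀⁻¹) ⊑ I₀ := (map_sub_iff φ g₀⁻¹).2 (by rwa [inv_inv])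
    have h3 := hL.elliptic.eq_of_sub (N.inv_mem hn) hI₀ (h1.trans h2)
    rw [h3] at h1
    have h4 := h1.antisymm h2
    refine hne ?_
    conv_lhs => rw [h4]
    exact map_map_inv φ g₀ I₀
  obtain ⟨j, u, hju, hu, hker, hirr, hmin⟩ := exists_action_of_cone _ htotP hneP
  have hcov := hL.isCovering hφ
  have hu_sub : ∀ g h, I₀.map (φ g) ⊑ I₀.map (φ h) → u g ≤ u h := by
    intro g h hgh
    refine hu g h ⟨1, N.one_mem, ?_⟩
    rw [one_mul, map_hom_mul, ← map_sub_iff]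
    exact hgh
  have huN : ∀ g, ∀ n ∈ N, u (g * n) = u g := by
    intro g n hn
    refine le_antisymm (hu _ _ ⟨n, hn, ?_⟩) (hu _ _ ⟨n⁻¹, N.inv_mem hn, ?_⟩)
    · rw [show n * ((g * n)⁻¹ * g) = 1 by group, map_hom_one]; exact Sub.refl _
    · rw [show n⁻¹ * (g⁻¹ * (g * n)) = 1 by group, map_hom_one]; exact Sub.refl _
  have hNker : N ≤ j.ker := by
    intro n hn
    refine hker n fun a => ?_
    rw [show n * a = a * (a⁻¹ * n * a) by group]
    refine huN a _ ?_
    have := ‹N.Normal›.conj_mem n hn a⁻¹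
    rwa [inv_inv] at this
  -- Positions of the translates of `I₀` containing the interval; their infimum is its height.
  let above : OpenInterval → Set ℝ := fun I => u '' {g | I ⊑ I₀.map (φ g)}
  have hne_above : ∀ I, (above I).Nonempty := by
    intro I
    obtain ⟨g, h1, h2⟩ := hφ.exists_map_gt hL.prelamination hL.invariant hI₀ I.1.1 I.1.2
    exact ⟨_, g, ⟨h1.le, h2.le⟩, rfl⟩
  have hbdd : ∀ I, BddBelow (above I) := by
    intro I
    obtain ⟨h, hh⟩ := hφ.exists_map_sub hL.prelamination hL.invariant hI₀ I
    refine ⟨u h, ?_⟩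
    rintro _ ⟨g, hg, rfl⟩
    exact hu_sub h g (hh.trans hg)
  have habove : ∀ (g : G) (I : OpenInterval), above (I.map (φ g)) = j g '' above I := by
    intro g I
    ext x
    constructor
    · rintro ⟨h, hh, rfl⟩
      refine ⟨u (g⁻¹ * h), ⟨g⁻¹ * h, ?_, rfl⟩, by rw [hju, mul_inv_cancel_left]⟩
      change I ⊑ _
      rw [map_hom_mul, ← map_sub_iff]
      exact hh
    · rintro ⟨_, ⟨h, hh, rfl⟩, rfl⟩
      refine ⟨g * h, ?_, (hju g h).symm⟩
      change I.map (φ g) ⊑ _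
      rw [map_hom_mul, map_sub_map]
      exact hh
  refine ⟨j, ⟨L, fun I => sInf (above I.1), ?_⟩, hNker, hmin⟩
  exact
    { laminar := ⟨hφ.isIrreducible, L, hL.prelamination, hcov, hL.invariant⟩
      irreducible := hirr
      lamination := ⟨hL.prelamination, hL.closed⟩
      covering := hcov
      invariant := hL.invariant
      monotone := fun I J h => csInf_le_csInf (hbdd I.1) (hne_above J.1)
        (Set.image_mono fun g hg => (toSet_subset_iff.1 h).trans hg)
      equivariant := fun g I => by
        change sInf (above (I.1.map (φ g))) = _
        rw [habove, OrderIso.map_csInf' _ (hne_above _) (hbdd _)] }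

end Horograding

/-! ### The prelamination of support components of an abelian normal subgroup. -/

section AbelianLamination

variable {φ : G →* HomeoPlus} {A : Subgroup G}

/-- The connected components of the supports of the elements of `A`. -/
def supportComponents (φ : G →* HomeoPlus) (A : Subgroup G) : Set OpenInterval :=
  {I | ∃ a ∈ A, φ a I.1.1 = I.1.1 ∧ φ a I.1.2 = I.1.2 ∧ ∀ x ∈ I.toSet, φ a x ≠ x}

theorem action_comm (hA : ⁅A, A⁆ ≤ φ.ker) {a b : G} (ha : a ∈ A) (hb : b ∈ A) (x : ℝ) :
    φ a (φ b x) = φ b (φ a x) := by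
  have h : φ (a * b * a⁻¹ * b⁻¹) = 1 := commutator_mem hA ha hb
  have h2 : φ (a * b) = φ (b * a) := by
    have : a * b = a * b * a⁻¹ * b⁻¹ * (b * a) := by group
    rw [this, map_mul φ _ (b * a), h, one_mul]
  rw [← action_mul, h2, action_mul]

/-- An element of an abelian group which maps a point of a component of the support of another
element into that component preserves the component. -/
theorem map_eq_of_mem_supportComponents (hA : ⁅A, A⁆ ≤ φ.ker) {I : OpenInterval}
    (hI : I ∈ supportComponents φ A) {b : G} (hb : b ∈ A) {x : ℝ} (hx : x ∈ I.toSet)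
    (hbx : φ b x ∈ I.toSet) : I.map (φ b) = I := by
  obtain ⟨a, ha, h1, h2, hI⟩ := hI
  have hfix : ∀ y, φ a (φ b y) = φ b y ↔ φ a y = y := fun y => by
    rw [action_comm hA ha hb, (φ b).injective.eq_iff]
  have hfix' : ∀ y, φ a (φ b⁻¹ y) = φ b⁻¹ y ↔ φ a y = y := fun y => by
    rw [← hfix, action_self_inv]
  have hb1 : φ b I.1.1 < φ b x := (φ b).strictMono hx.1
  have hb2 : φ b x < φ b I.1.2 := (φ b).strictMono hx.2
  -- `b` preserves the fixed-point set of `a`, which misses `I`, so neither `b` nor `b⁻¹` can move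
  -- an end of `I` into `I`.
  have e1 : φ b I.1.1 = I.1.1 := by
    refine le_antisymm (not_lt.1 fun h => ?_) (not_lt.1 fun h => ?_)
    · exact hI _ ⟨h, hb1.trans hbx.2⟩ ((hfix _).2 h1)
    · exact hI _ ⟨(lt_action_inv φ b).2 h, ((action_inv_lt φ b).2 hbx.1).trans hx.2⟩ ((hfix' _).2 h1)
  have e2 : φ b I.1.2 = I.1.2 := by
    refine le_antisymm (not_lt.1 fun h => ?_) (not_lt.1 fun h => ?_)
    · exact hI _ ⟨hx.1.trans ((lt_action_inv φ b).2 hbx.2), (action_inv_lt φ b).2 h⟩ ((hfix' _).2 h2)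
    · exact hI _ ⟨hbx.1.trans hb2, h⟩ ((hfix _).2 h2)
  exact Subtype.ext (Prod.ext e1 e2)

/-- If `I` crosses `J` from the left, the element defining `J` fixes the left end of `J`, a point of
`I`. It therefore preserves `I` and fixes its right end, which lies in `J`. -/
theorem isPrelamination_supportComponents (hA : ⁅A, A⁆ ≤ φ.ker) :
    IsPrelamination (supportComponents φ A) := by
  rw [isPrelamination_iff]
  rintro I hI J ⟨b, hb, h1, h2, hJ⟩ hlt1 hlt2 hlt3
  have hmem : J.1.1 ∈ I.toSet := ⟨hlt1, hlt2⟩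
  have := map_eq_of_mem_supportComponents hA hI hb hmem (by rwa [h1])
  exact hJ I.1.2 ⟨hlt2, hlt3⟩ (congrArg (fun K : OpenInterval => K.1.2) this)

theorem isInvariant_supportComponents [A.Normal] : IsInvariant φ (supportComponents φ A) := by
  rintro g I ⟨a, ha, h1, h2, hI⟩
  have hconj : ∀ x, φ (g * a * g⁻¹) (φ g x) = φ g (φ a x) := fun x => by
    rw [← action_mul, inv_mul_cancel_right, action_mul]
  refine ⟨g * a * g⁻¹, ‹A.Normal›.conj_mem a ha g, ?_, ?_, fun x hx he => ?_⟩
  · rw [map_fst, hconj, h1]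
  · rw [map_snd, hconj, h2]
  · refine hI (φ g⁻¹ x) ⟨(lt_action_inv φ g).2 hx.1, (action_inv_lt φ g).2 hx.2⟩ ?_
    have h3 := congrArg (φ g⁻¹) (hconj (φ g⁻¹ x))
    rw [action_self_inv, he, action_inv_self] at h3
    exact h3.symm

/-- Conjugation invariance spreads the common fixed point along its dense orbit. -/
theorem IsMinimal.eq_one_of_fixed (hφ : IsMinimal φ) {K : Set G}
    (hK : ∀ g : G, ∀ k ∈ K, g * k * g⁻¹ ∈ K) {p : ℝ} (hp : ∀ k ∈ K, φ k p = p) :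
    ∀ k ∈ K, φ k = 1 := by
  intro k hk
  have hclosed : IsClosed {x | φ k x = x} := isClosed_eq (φ k).continuous continuous_id
  have hsub : Set.range (fun g : G => φ g p) ⊆ {x | φ k x = x} := by
    rintro _ ⟨g, rfl⟩
    have := hp _ (by simpa using hK g⁻¹ k hk : g⁻¹ * k * g ∈ K)
    rw [action_mul, action_mul] at this
    have h2 := congrArg (φ g) this
    rwa [action_self_inv] at h2
  have huniv : {x | φ k x = x} = Set.univ := by
    rw [← hclosed.closure_eq]
    exact ((hφ p).mono hsub).closure_eq
  ext x
  have : x ∈ {x | φ k x = x} := huniv ▸ Set.mem_univ x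
  exact this

end AbelianLamination

end LineAction

namespace LineAction
variable {G : Type*} [Group G]
open OpenInterval

section AbelianLamination

variable {φ : G →* HomeoPlus} {A : Subgroup G}

/-- The extremal points of the fixed point set of an element of an abelian group are global fixed
points. -/
theorem fixed_of_isLeast (hA : ⁅A, A⁆ ≤ φ.ker) {a : G} (ha : a ∈ A) {m : ℝ}
    (hm : IsLeast {x | φ a x = x} m) {b : G} (hb : b ∈ A) : φ b m = m := by
  have h : ∀ b ∈ A, m ≤ φ b m := fun b hb => hm.2 (by
    change φ a (φ b m) = φ b m
    rw [action_comm hA ha hb, hm.1])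
  refine le_antisymm ?_ (h b hb)
  have := (φ b).monotone (h b⁻¹ (A.inv_mem hb))
  rwa [action_self_inv] at this

theorem fixed_of_isGreatest (hA : ⁅A, A⁆ ≤ φ.ker) {a : G} (ha : a ∈ A) {m : ℝ}
    (hm : IsGreatest {x | φ a x = x} m) {b : G} (hb : b ∈ A) : φ b m = m := by
  have h : ∀ b ∈ A, φ b m ≤ m := fun b hb => hm.2 (by
    change φ a (φ b m) = φ b m
    rw [action_comm hA ha hb, hm.1])
  refine le_antisymm (h b hb) ?_
  have := (φ b).monotone (h b⁻¹ (A.inv_mem hb))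
  rwa [action_self_inv] at this

/-- Take the gap around a moved point. It is bounded: an extremal fixed point of `a` would be fixed
by all of `A`, which would then act trivially. -/
theorem IsMinimal.supportComponents_nonempty [A.Normal] (hφ : IsMinimal φ) (hA : ⁅A, A⁆ ≤ φ.ker)
    {a : G} (ha : a ∈ A) (hne : φ a ≠ 1) (hfix : ∃ x, φ a x = x) :
    (supportComponents φ A).Nonempty := by
  have hconj : ∀ g : G, ∀ k ∈ (A : Set G), g * k * g⁻¹ ∈ (A : Set G) := fun g k hk =>
    ‹A.Normal›.conj_mem k hk g
  obtain ⟨z, hz⟩ := hfix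
  obtain ⟨x, hx⟩ : ∃ x, φ a x ≠ x := by
    by_contra! h
    exact hne (by ext x; exact h x)
  set F : Set ℝ := {x | φ a x = x} with hF
  have hclosed : IsClosed F := isClosed_eq (φ a).continuous continuous_id
  have hleft : (F ∩ Set.Iic x).Nonempty := by
    by_contra hno
    have hb : BddBelow F := ⟨x, fun y hy => le_of_not_gt fun h => hno ⟨y, hy, h.le⟩⟩
    have hm : IsLeast F (sInf F) := ⟨hclosed.csInf_mem ⟨z, hz⟩ hb, fun y hy => csInf_le hb hy⟩
    exact hne (hφ.eq_one_of_fixed hconj (fun b hb => fixed_of_isLeast hA ha hm hb) a ha)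
  have hright : (F ∩ Set.Ici x).Nonempty := by
    by_contra hno
    have hb : BddAbove F := ⟨x, fun y hy => le_of_not_gt fun h => hno ⟨y, hy, h.le⟩⟩
    have hm : IsGreatest F (sSup F) := ⟨hclosed.csSup_mem ⟨z, hz⟩ hb, fun y hy => le_csSup hb hy⟩
    exact hne (hφ.eq_one_of_fixed hconj (fun b hb => fixed_of_isGreatest hA ha hm hb) a ha)
  have hb1 : BddAbove (F ∩ Set.Iic x) := ⟨x, fun y hy => hy.2⟩
  have hb2 : BddBelow (F ∩ Set.Ici x) := ⟨x, fun y hy => hy.2⟩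
  have h1 := (hclosed.inter isClosed_Iic).csSup_mem hleft hb1
  have h2 := (hclosed.inter isClosed_Ici).csInf_mem hright hb2
  have h1x : sSup (F ∩ Set.Iic x) < x := lt_of_le_of_ne h1.2 fun h => hx (by
    have := h1.1; rw [h] at this; exact this)
  have h2x : x < sInf (F ∩ Set.Ici x) := lt_of_le_of_ne h2.2 fun h => hx (by
    have := h2.1; rw [← h] at this; exact this)
  refine ⟨⟨(_, _), h1x.trans h2x⟩, a, ha, h1.1, h2.1, fun y hy hfy => ?_⟩
  rcases le_total y x with h | h
  · exact absurd (le_csSup hb1 ⟨hfy, h⟩) (not_le.2 hy.1)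
  · exact absurd (csInf_le hb2 ⟨hfy, h⟩) (not_le.2 hy.2)

/-- An element acting unipotently on an abelian normal subgroup does not strictly enlarge the
components of the supports. -/
theorem isElliptic_supportComponents [A.Normal] (hA : ⁅A, A⁆ ≤ φ.ker) {F : Subgroup G}
    (hF : ∀ f ∈ F, ∀ a ∈ A, ∃ k : ℕ, φ ((fun y => f * y * f⁻¹ * y⁻¹)^[k] a) = 1) :
    IsElliptic φ F (supportComponents φ A) := by
  intro f hf J hJ hs
  by_contra hne
  -- A strict enlargement sends some interior point `z` of `J` to an end of `J`.
  obtain ⟨z, hz, hfz⟩ : ∃ z ∈ J.toSet, φ f z = J.1.1 ∨ φ f z = J.1.2 := by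
    by_cases h : J.1.2 < φ f J.1.2
    · exact ⟨φ f⁻¹ J.1.2, ⟨(lt_action_inv φ f).2 (hs.1.trans_lt J.2), (action_inv_lt φ f).2 h⟩,
        Or.inr (action_self_inv _ _ _)⟩
    · have h1 : φ f J.1.1 < J.1.1 := lt_of_le_of_ne hs.1 fun he =>
        hne (Subtype.ext (Prod.ext he (le_antisymm (not_lt.1 h) hs.2)))
      exact ⟨φ f⁻¹ J.1.1, ⟨(lt_action_inv φ f).2 h1, (action_inv_lt φ f).2 (J.2.trans_le hs.2)⟩,
        Or.inl (action_self_inv _ _ _)⟩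
  obtain ⟨a, ha, ha1, ha2, hmove⟩ := id hJ
  obtain ⟨k, hk⟩ := hF f hf a ha
  -- The `i`-th iterated commutator fixes the ends of the `f ^ i` translate of `J` but moves the
  -- translate of `z`, so none acts trivially.
  have key : ∀ i : ℕ, (fun y => f * y * f⁻¹ * y⁻¹)^[i] a ∈ A ∧
      φ ((fun y => f * y * f⁻¹ * y⁻¹)^[i] a) (φ (f ^ i) J.1.1) = φ (f ^ i) J.1.1 ∧
      φ ((fun y => f * y * f⁻¹ * y⁻¹)^[i] a) (φ (f ^ i) J.1.2) = φ (f ^ i) J.1.2 ∧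
      φ ((fun y => f * y * f⁻¹ * y⁻¹)^[i] a) (φ (f ^ i) z) ≠ φ (f ^ i) z := by
    intro i
    induction i with
    | zero =>
      simp only [Function.iterate_zero, id, pow_zero, action_one]
      exact ⟨ha, ha1, ha2, hmove z hz⟩
    | succ i ih =>
      rw [Function.iterate_succ_apply']
      generalize (fun y => f * y * f⁻¹ * y⁻¹)^[i] a = b at ih ⊢
      obtain ⟨hb, hb1, hb2, hbz⟩ := ih
      -- This point is the `f ^ i` translate of an end of `J`. Being fixed by `b`, it forces `b` to
      -- preserve the next translate, so the commutator acts there on these points as the conjugate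
      -- of `b`.
      have hy : φ b (φ (f ^ (i + 1)) z) = φ (f ^ (i + 1)) z := by
        rw [pow_succ, action_mul]
        rcases hfz with h | h <;> rw [h] <;> assumption
      have hymem : φ (f ^ (i + 1)) z ∈ (J.map (φ (f ^ (i + 1)))).toSet :=
        ⟨(φ _).strictMono hz.1, (φ _).strictMono hz.2⟩
      have heq := map_eq_of_mem_supportComponents hA
        (isInvariant_supportComponents (f ^ (i + 1)) J hJ) hb hymem (by rwa [hy])
      have hinv : ∀ w, φ b w = w → φ b⁻¹ w = w := fun w hw => by
        conv_lhs => rw [← hw]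
        exact action_inv_self φ b w
      have h1 : φ b⁻¹ (φ (f ^ (i + 1)) J.1.1) = φ (f ^ (i + 1)) J.1.1 :=
        hinv _ (congrArg (fun K : OpenInterval => K.1.1) heq)
      have h2 : φ b⁻¹ (φ (f ^ (i + 1)) J.1.2) = φ (f ^ (i + 1)) J.1.2 :=
        hinv _ (congrArg (fun K : OpenInterval => K.1.2) heq)
      have hstep : ∀ w, φ b⁻¹ (φ (f ^ (i + 1)) w) = φ (f ^ (i + 1)) w →
          φ (f * b * f⁻¹ * b⁻¹) (φ (f ^ (i + 1)) w) = φ f (φ b (φ (f ^ i) w)) := by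
        intro w hw
        rw [action_mul, hw, action_mul, action_mul, pow_succ', action_mul φ f, action_inv_self]
      refine ⟨A.mul_mem (‹A.Normal›.conj_mem b hb f) (A.inv_mem hb), ?_, ?_, ?_⟩
      · rw [hstep _ h1, hb1, pow_succ', action_mul]
      · rw [hstep _ h2, hb2, pow_succ', action_mul]
      · rw [hstep _ (hinv _ hy), pow_succ', action_mul]
        exact fun h => hbz ((φ f).injective h)
  exact (key k).2.2.2 (by rw [hk]; rfl)

end AbelianLamination

/-! ### The Fitting subgroup consists of left Engel elements. -/

section Fitting

/-- The subgroup `K` acts nilpotently on `G` by conjugation, in a chain of normal subgroups. -/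
def HasCentralChain (K : Subgroup G) : Prop :=
  ∃ (C : ℕ → Subgroup G) (c : ℕ), (∀ i, (C i).Normal) ∧ C 0 = ⊤ ∧ (∀ i, c ≤ i → C i = ⊥) ∧
    ∀ i, ⁅C i, K⁆ ≤ C (i + 1)

/-- Prepend `⊤` to the lower central series of `K`; normality gives the first step. -/
theorem hasCentralChain_of_isNilpotent {K : Subgroup G} [K.Normal] (hK : Group.IsNilpotent K) :
    HasCentralChain K := by
  obtain ⟨n, hn⟩ := (Subgroup.isNilpotent_iff_lowerCentralSeries K).1 hK
  refine ⟨fun i => Nat.casesOn i ⊤ fun i => K.lowerCentralSeries i, n + 1, fun i => ?_, rfl,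
    fun i hi => ?_, fun i => ?_⟩
  · cases i with
    | zero => exact (inferInstance : (⊤ : Subgroup G).Normal)
    | succ i => exact Subgroup.lowerCentralSeries_normal K i
  · obtain ⟨i, rfl⟩ : ∃ k, i = k + 1 := ⟨i - 1, by omega⟩
    exact le_bot_iff.1 (hn ▸ K.lowerCentralSeries_antitone (by omega : n ≤ i))
  · cases i with
    | zero => exact Subgroup.commutator_le_right _ _
    | succ i => exact (K.lowerCentralSeries_succ i).ge

theorem iSup_commutator_le {ι : Sort*} {X : ι → Subgroup G} {Y Z : Subgroup G} [Z.Normal]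
    (h : ∀ i, ⁅X i, Y⁆ ≤ Z) : ⁅⨆ i, X i, Y⁆ ≤ Z := by
  rw [commutator_le_iff_map_le, Subgroup.map_iSup]
  exact iSup_le fun i => commutator_le_iff_map_le.1 (h i)

theorem normal_iSup {ι : Sort*} {X : ι → Subgroup G} (h : ∀ i, (X i).Normal) :
    (⨆ i, X i).Normal := by
  constructor
  intro n hn g
  have : (⨆ i, X i).map (MulAut.conj g).toMonoidHom ≤ ⨆ i, X i := by
    rw [Subgroup.map_iSup]
    refine iSup_mono fun i => ?_
    rintro _ ⟨x, hx, rfl⟩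
    exact (h i).conj_mem x hx g
  exact this ⟨n, hn, rfl⟩

/-- As in Fitting's theorem, filter by total depth `i + j`: commutators with `K` raise `i`, those
with `K'` raise `j`, and normality keeps the other index. -/
theorem HasCentralChain.sup {K K' : Subgroup G} (h : HasCentralChain K) (h' : HasCentralChain K') :
    HasCentralChain (K ⊔ K') := by
  obtain ⟨C, c, hC, hC0, hCc, hCK⟩ := h
  obtain ⟨C', c', hC', hC0', hCc', hCK'⟩ := h'
  have hnormal : ∀ i j, (C i ⊓ C' j).Normal := fun i j => by
    have := hC i; have := hC' j; infer_instance
  let W : ℕ → Subgroup G := fun n => ⨆ i : ℕ, ⨆ j : ℕ, ⨆ _ : i + j = n, C i ⊓ C' j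
  have hle : ∀ i j n, i + j = n → C i ⊓ C' j ≤ W n := fun i j n hn =>
    le_iSup_of_le i (le_iSup_of_le j (le_iSup_of_le hn le_rfl))
  have hW : ∀ n, (W n).Normal := fun n =>
    normal_iSup fun i => normal_iSup fun j => normal_iSup fun _ => hnormal i j
  refine ⟨W, c + c', hW, ?_, fun n hn => ?_, fun n => ?_⟩
  · refine top_le_iff.1 (le_trans ?_ (hle 0 0 0 rfl))
    rw [hC0, hC0', inf_top_eq]
  · refine le_bot_iff.1 (iSup_le fun i => iSup_le fun j => iSup_le fun hij => ?_)
    rcases le_or_gt c i with hi | hi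
    · rw [hCc i hi]; exact inf_le_left
    · rw [hCc' j (by omega)]; exact inf_le_right
  · have := hW (n + 1)
    refine iSup_commutator_le fun i => iSup_commutator_le fun j => iSup_commutator_le fun hij => ?_
    have := hC i
    have := hC' j
    rw [Subgroup.commutator_comm]
    refine sup_commutator_le ?_ ?_ <;> rw [Subgroup.commutator_comm]
    · refine le_trans (le_inf ?_ ?_) (hle (i + 1) j (n + 1) (by omega))
      · exact (Subgroup.commutator_mono inf_le_left le_rfl).trans (hCK i)
      · exact (Subgroup.commutator_mono inf_le_right le_rfl).trans (Subgroup.commutator_le_left _ _)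
    · refine le_trans (le_inf ?_ ?_) (hle i (j + 1) (n + 1) (by omega))
      · exact (Subgroup.commutator_mono inf_le_left le_rfl).trans (Subgroup.commutator_le_left _ _)
      · exact (Subgroup.commutator_mono inf_le_right le_rfl).trans (hCK' j)

theorem exists_hasCentralChain_of_mem_fitting {f : G} (hf : f ∈ fitting G) :
    ∃ K : Subgroup G, HasCentralChain K ∧ f ∈ K := by
  let F : Subgroup G :=
    { carrier := {f | ∃ K : Subgroup G, HasCentralChain K ∧ f ∈ K}
      one_mem' := ⟨⊥, hasCentralChain_of_isNilpotent inferInstance, Subgroup.one_mem _⟩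
      mul_mem' := by
        rintro a b ⟨K, hK, ha⟩ ⟨K', hK', hb⟩
        exact ⟨K ⊔ K', hK.sup hK', Subgroup.mul_mem_sup ha hb⟩
      inv_mem' := by
        rintro a ⟨K, hK, ha⟩
        exact ⟨K, hK, K.inv_mem ha⟩ }
  have : fitting G ≤ F := sSup_le fun M hM x hx => by
    have := hM.1
    exact ⟨M, hasCentralChain_of_isNilpotent hM.2, hx⟩
  exact this hf

/-- Elements of the Fitting subgroup are left Engel. -/
theorem engel_of_mem_fitting {f : G} (hf : f ∈ fitting G) (a : G) :
    ∃ k : ℕ, (fun y => f * y * f⁻¹ * y⁻¹)^[k] a = 1 := by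
  obtain ⟨K, ⟨C, c, hC, hC0, hCc, hCK⟩, hfK⟩ := exists_hasCentralChain_of_mem_fitting hf
  have : ∀ i, (fun y => f * y * f⁻¹ * y⁻¹)^[i] a ∈ C i := by
    intro i
    induction i with
    | zero => rw [hC0]; trivial
    | succ i ih =>
      rw [Function.iterate_succ_apply']
      exact commutator_mem ((Subgroup.commutator_comm _ _).trans_le (hCK i)) hfK ih
  exact ⟨c, by have := this c; rwa [hCc c le_rfl, Subgroup.mem_bot] at this⟩

instance fitting_normal : (fitting G).Normal := by
  rw [fitting, sSup_eq_iSup]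
  exact normal_iSup fun M => normal_iSup fun hM => hM.1

end Fitting

end LineAction

/-! ### Dynamics of a homeomorphism without fixed points. -/

namespace LineAction
variable {G : Type*} [Group G]

section Displacement

variable {e : HomeoPlus}

theorem forall_lt_or_forall_gt (h : ∀ x, e x ≠ x) : (∀ x, x < e x) ∨ ∀ x, e x < x := by
  by_contra! hno
  obtain ⟨⟨x, hx⟩, ⟨y, hy⟩⟩ := hno
  obtain ⟨c, hc⟩ := mem_range_of_exists_le_of_exists_ge (f := fun z => e z - z) (c := 0)
    (e.continuous.sub continuous_id) ⟨x, sub_nonpos.2 hx⟩ ⟨y, sub_nonneg.2 hy⟩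
  exact h c (sub_eq_zero.1 hc)

theorem zpow_apply_eq_self {x : ℝ} (h : e x = x) (n : ℤ) : (e ^ n) x = x := by
  induction n using Int.induction_on with
  | zero => rfl
  | succ n ih => rw [zpow_add_one, RelIso.mul_apply, h, ih]
  | pred n ih =>
    have h' : e⁻¹ x = x := by
      conv_lhs => rw [← h]
      exact RelIso.inv_apply_self _ _
    rw [zpow_sub_one, RelIso.mul_apply, h', ih]

theorem strictMono_zpow (h : ∀ x, x < e x) (x : ℝ) : StrictMono fun n : ℤ => (e ^ n) x :=
  strictMono_int_of_lt_succ fun n => by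
    rw [add_comm, zpow_one_add, RelIso.mul_apply]
    exact h _

theorem exists_lt_pow (h : ∀ x, x < e x) (x y : ℝ) : ∃ n : ℕ, y < (e ^ n) x := by
  by_contra! hno
  have hbdd : BddAbove (Set.range fun n : ℕ => (e ^ n) x) := ⟨y, by
    rintro _ ⟨n, rfl⟩
    exact hno n⟩
  refine absurd (h (sSup (Set.range fun n : ℕ => (e ^ n) x))) (not_lt.2 ?_)
  rw [OrderIso.map_csSup' _ (Set.range_nonempty _) hbdd]
  refine csSup_le ((Set.range_nonempty _).image _) ?_
  rintro _ ⟨_, ⟨n, rfl⟩, rfl⟩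
  refine le_csSup hbdd ⟨n + 1, ?_⟩
  simp only [pow_succ', RelIso.mul_apply]

theorem zpow_le_iff {n : ℤ} {x y : ℝ} : (e ^ n) x ≤ y ↔ x ≤ (e ^ (-n)) y := by
  rw [← (e ^ (-n)).le_iff_le, ← RelIso.mul_apply, ← zpow_add, neg_add_cancel, zpow_zero]
  rfl

theorem lt_zpow_iff {n : ℤ} {x y : ℝ} : x < (e ^ n) y ↔ (e ^ (-n)) x < y := by
  rw [← (e ^ (-n)).lt_iff_lt, ← RelIso.mul_apply (e ^ (-n)) (e ^ n), ← zpow_add, neg_add_cancel,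
    zpow_zero]
  rfl

/-- `[x, e x)` is a fundamental domain for the powers of `e`. -/
theorem exists_zpow_mem (h : ∀ x, x < e x) (x p : ℝ) :
    ∃ m : ℤ, x ≤ (e ^ m) p ∧ (e ^ m) p < e x := by
  obtain ⟨n, hn⟩ := exists_lt_pow h x p
  obtain ⟨k, hk⟩ := exists_lt_pow h p x
  obtain ⟨m, hm, hmax⟩ := Int.exists_greatest_of_bdd (P := fun m : ℤ => (e ^ m) x ≤ p)
    ⟨n, fun z hz => (strictMono_zpow h x).le_iff_le.1 (by
      simp only [zpow_natCast]; exact hz.trans hn.le)⟩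
    ⟨-k, by rw [zpow_le_iff, neg_neg, zpow_natCast]; exact hk.le⟩
  refine ⟨-m, zpow_le_iff.1 hm, ?_⟩
  rw [← lt_zpow_iff, ← RelIso.mul_apply, ← zpow_add_one]
  by_contra hlt
  have := hmax (m + 1) (not_lt.1 hlt)
  omega

theorem zpow_unique (h : ∀ x, x < e x) {x p : ℝ} {m n : ℤ} (h1 : x ≤ (e ^ m) p)
    (h2 : (e ^ m) p < e x) (h3 : x ≤ (e ^ n) p) (h4 : (e ^ n) p < e x) : m = n := by
  by_contra hne
  wlog hmn : m < n generalizing m n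
  · exact this h3 h4 h1 h2 (Ne.symm hne) (by omega)
  have h5 : (e ^ (m + 1)) p ≤ (e ^ n) p := (strictMono_zpow h p).monotone (by omega)
  rw [add_comm, zpow_one_add, RelIso.mul_apply] at h5
  exact absurd ((e.monotone h1).trans h5) (not_le.2 h4)

/-- Commutation reduces the bound to the fundamental domain `[0, e 0)`. -/
theorem exists_forall_lt_pow (h : ∀ x, x < e x) {f : HomeoPlus} (hc : Commute e f) :
    ∃ m : ℕ, ∀ z, f z < (e ^ m) z := by
  obtain ⟨m, hm⟩ := exists_lt_pow h 0 (f (e 0))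
  refine ⟨m, fun z => ?_⟩
  obtain ⟨i, hi1, hi2⟩ := exists_zpow_mem h 0 z
  rw [← (e ^ i).lt_iff_lt, ← RelIso.mul_apply, ← RelIso.mul_apply, (hc.zpow_left i).eq,
    (Commute.pow_right (Commute.zpow_left (Commute.refl e) i) m).eq, RelIso.mul_apply,
    RelIso.mul_apply]
  exact (f.strictMono hi2).trans (hm.trans_le ((e ^ m).monotone hi1))

/-- Conjugating `g ^ n` by `f` multiplies it by `e ^ (k * n)`, yet conjugation by `f` displaces by
less than a fixed power `e ^ (m + m')`; `n = m + m'` already contradicts `0 < k`. -/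
theorem zpow_ne_of_commutator_pos (h : ∀ x, x < e x) {f g : HomeoPlus} (hf : Commute e f)
    (hg : Commute e g) {k : ℤ} (hk : f * g * f⁻¹ * g⁻¹ = e ^ k) : ¬ 0 < k := by
  intro hpos
  obtain ⟨m, hm⟩ := exists_forall_lt_pow h hf
  obtain ⟨m', hm'⟩ := exists_forall_lt_pow h hf.inv_right
  have h1 : f * g * f⁻¹ = e ^ k * g := by rw [← hk]; group
  have h2 : f * g ^ (m + m') * f⁻¹ = (e ^ k) ^ (m + m') * g ^ (m + m') := by
    rw [← conj_pow, h1, (hg.zpow_left k).mul_pow]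
  have h3 : (f * g ^ (m + m') * f⁻¹) 0 < (e ^ (m + m') * g ^ (m + m')) 0 := by
    have h4 : (g ^ (m + m')) (f⁻¹ 0) < (g ^ (m + m')) ((e ^ m') 0) :=
      (g ^ (m + m')).strictMono (hm' 0)
    have h5 : (e ^ m) ((g ^ (m + m')) ((e ^ m') 0)) = (e ^ (m + m') * g ^ (m + m')) 0 := by
      rw [← RelIso.mul_apply, ← RelIso.mul_apply, pow_add e, mul_assoc, mul_assoc,
        (hg.pow_pow m' (m + m')).eq]
    rw [RelIso.mul_apply, RelIso.mul_apply, ← h5]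
    exact (hm _).trans ((e ^ m).strictMono h4)
  rw [h2, RelIso.mul_apply, RelIso.mul_apply, ← zpow_natCast, ← zpow_mul, ← zpow_natCast e] at h3
  have h6 := (strictMono_zpow h _).lt_iff_lt.1 h3
  push_cast at h6
  nlinarith

/-- A commutator of two elements of a central extension by a translation is not a non-trivial power
of that translation. -/
theorem eq_zero_of_commutator_eq_zpow (h : ∀ x, x < e x) {f g : HomeoPlus} (hf : Commute e f)
    (hg : Commute e g) {k : ℤ} (hk : f * g * f⁻¹ * g⁻¹ = e ^ k) : k = 0 := by
  have h1 := zpow_ne_of_commutator_pos h hf hg hk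
  have h2 := zpow_ne_of_commutator_pos h hg hf (k := -k) (by rw [zpow_neg, ← hk]; group)
  omega

end Displacement

/-! ### Free abelian actions and Hölder's theorem. -/

section Free

variable {φ : G →* HomeoPlus} {A : Subgroup G}

/-- An abelian normal subgroup of a minimal action which contains an element without fixed points
acts freely. -/
theorem IsMinimal.eq_one_of_fixed_of_free [A.Normal] (hφ : IsMinimal φ) (hA : ⁅A, A⁆ ≤ φ.ker)
    {f : G} (hf : f ∈ A) (hlt : ∀ x, x < φ f x) {a : G} (ha : a ∈ A) {x : ℝ} (hx : φ a x = x) :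
    φ a = 1 := by
  let K : Set G := {a | a ∈ A ∧ ∃ x, φ a x = x}
  have hK : ∀ g : G, ∀ k ∈ K, g * k * g⁻¹ ∈ K := by
    rintro g k ⟨hk, y, hy⟩
    refine ⟨‹A.Normal›.conj_mem k hk g, φ g y, ?_⟩
    rw [← action_mul, inv_mul_cancel_right, action_mul, hy]
  have hzpow : ∀ (a : G) (n : ℤ) (x : ℝ), (φ a ^ n) x = φ (a ^ n) x := fun a n x => by
    rw [map_zpow]
  have hmove : ∀ b ∈ A, ∀ c ∈ A, ∀ p, φ b p = p → φ b (φ c p) = φ c p := fun b hb c hc p hp => by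
    rw [action_comm hA hb hc, hp]
  have hfin : ∀ T : Finset K, ∃ p, ∀ k ∈ T, φ (k : G) p = p := by
    classical
    intro T
    induction T using Finset.induction_on with
    | empty => exact ⟨0, by simp⟩
    | insert k T _ ih =>
      obtain ⟨p, hp⟩ := ih
      obtain ⟨k, hk, q, hq⟩ := k
      obtain ⟨n, hn⟩ := exists_lt_pow hlt q p
      have hq' : φ k (φ (f ^ n) q) = φ (f ^ n) q := hmove k hk _ (A.pow_mem hf n) q hq
      rw [← map_pow] at hn
      have hqz : ∀ m : ℤ, φ (k ^ m) (φ (f ^ n) q) = φ (f ^ n) q := by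
        intro m
        rw [← hzpow]
        exact zpow_apply_eq_self hq' m
      have hbdd : BddAbove (Set.range fun m : ℤ => φ (k ^ m) p) := ⟨φ (f ^ n) q, by
        rintro _ ⟨m, rfl⟩
        rw [← hqz m]
        exact (φ _).monotone hn.le⟩
      -- The supremum of the orbit of `p` under `k` is fixed by `k` and, by commutation, by the
      -- earlier elements.
      refine ⟨sSup (Set.range fun m : ℤ => φ (k ^ m) p), fun c hc => ?_⟩
      rw [OrderIso.map_csSup' _ (Set.range_nonempty _) hbdd]
      congr 1
      rw [← Set.range_comp]
      rcases Finset.mem_insert.1 hc with rfl | hc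
      · refine Set.Subset.antisymm ?_ ?_
        · rintro _ ⟨m, rfl⟩
          exact ⟨m + 1, by simp only [Function.comp, ← action_mul, add_comm m, zpow_one_add]⟩
        · rintro _ ⟨m, rfl⟩
          exact ⟨m - 1, by simp only [Function.comp, ← action_mul, ← zpow_one_add]; simp⟩
      · congr 1
        funext m
        exact hmove _ c.2.1 _ (A.zpow_mem hk m) p (hp c hc)
  -- Powers of `f` bring common fixed points into a compact interval, so finite families suffice.
  have hcompact : (Set.Icc 0 (φ f 0) ∩ ⋂ k : K, {x | φ (k : G) x = x}).Nonempty := by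
    refine isCompact_Icc.inter_iInter_nonempty _
      (fun k => isClosed_eq (φ (k : G)).continuous continuous_id) fun T => ?_
    obtain ⟨p, hp⟩ := hfin T
    obtain ⟨m, h1, h2⟩ := exists_zpow_mem hlt 0 p
    refine ⟨(φ f ^ m) p, ⟨h1, h2.le⟩, Set.mem_iInter₂.2 fun k hk => ?_⟩
    rw [hzpow]
    exact hmove _ k.2.1 _ (A.zpow_mem hf m) p (hp k hk)
  obtain ⟨p, _, hp⟩ := hcompact
  exact hφ.eq_one_of_fixed hK (fun k hk => Set.mem_iInter.1 hp ⟨k, hk⟩) a ⟨ha, x, hx⟩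

/-- Hölder's theorem: an abelian group acting freely on the line embeds into the real numbers. -/
theorem exists_translation_number {Q : Subgroup HomeoPlus} (hcomm : ∀ a ∈ Q, ∀ b ∈ Q, a * b = b * a)
    (hfree : ∀ a ∈ Q, ∀ x, a x = x → a = 1) :
    ∃ τ : Q → ℝ, (∀ a b, τ (a * b) = τ a + τ b) ∧ ∀ a b x, τ a < τ b ↔ a.1 x < b.1 x := by
  have hfree' : ∀ a b : Q, ∀ x, a.1 x = b.1 x → a = b := by
    intro a b x h
    have := hfree (b.1⁻¹ * a.1) (Q.mul_mem (Q.inv_mem b.2) a.2) x (by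
      rw [RelIso.mul_apply, h]
      exact RelIso.inv_apply_self _ _)
    exact Subtype.ext (inv_mul_eq_one.1 this).symm
  -- By freeness and the intermediate value theorem graphs never cross, so comparison at `0` is an
  -- invariant order.
  have hindep : ∀ a b : Q, ∀ x y, a.1 x < b.1 x → a.1 y < b.1 y := by
    intro a b x y h
    by_contra hno
    obtain ⟨c, hc⟩ := mem_range_of_exists_le_of_exists_ge (f := fun z => a.1 z - b.1 z) (c := 0)
      (a.1.continuous.sub b.1.continuous) ⟨x, sub_nonpos.2 h.le⟩ ⟨y, sub_nonneg.2 (not_lt.1 hno)⟩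
    have := hfree' a b c (sub_eq_zero.1 hc)
    rw [this] at h
    exact lt_irrefl _ h
  let _ : CommGroup Q := { (inferInstance : Group Q) with
    mul_comm := fun a b => Subtype.ext (hcomm a a.2 b b.2) }
  let _ : LinearOrder (Additive Q) := LinearOrder.lift' (fun a => a.toMul.1 0) fun a b h =>
    hfree' _ _ 0 h
  have lt_def : ∀ a b : Additive Q, a < b ↔ a.toMul.1 0 < b.toMul.1 0 := fun a b => Iff.rfl
  have le_def : ∀ a b : Additive Q, a ≤ b ↔ a.toMul.1 0 ≤ b.toMul.1 0 := fun a b => Iff.rfl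
  have : IsOrderedAddMonoid (Additive Q) := IsOrderedAddMonoid.mk (fun a b h c => by
    rw [add_comm a, add_comm b, le_def]
    exact (c.toMul.1).monotone h) fun a b h c => by
    rw [le_def]
    exact (c.toMul.1).monotone h
  have : Archimedean (Additive Q) := ⟨fun x y hy => by
    obtain ⟨n, hn⟩ := exists_lt_pow (e := y.toMul.1) (fun z => hindep 1 _ 0 z hy) 0 (x.toMul.1 0)
    refine ⟨n, ?_⟩
    rw [le_def]
    exact hn.le⟩
  obtain ⟨τ, hτ⟩ := Archimedean.exists_orderAddMonoidHom_real_injective (Additive Q)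
  have hmono : StrictMono τ := τ.monotone'.strictMono_of_injective hτ
  refine ⟨fun a => τ (Additive.ofMul a), fun a b => ?_, fun a b x => ?_⟩
  · exact map_add τ (Additive.ofMul a) (Additive.ofMul b)
  · rw [hmono.lt_iff_lt, lt_def]
    exact ⟨fun h => hindep a b 0 x h, fun h => hindep a b x 0 h⟩

end Free

end LineAction

/-! ### Straightening to an affine action. -/

namespace LineAction
variable {G : Type*} [Group G]

/-- The action is conjugate to an affine action. -/
def IsConjugateToAffine (φ : G →* HomeoPlus) : Prop :=
  ∃ ψ : G →* HomeoPlus, IsAffine ψ ∧ IsConjugate φ ψ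

/-- A homeomorphism normalising a dense group of translations is affine. -/
theorem affine_of_normalizes {S : Set ℝ} (hS : Dense S) {F : HomeoPlus}
    (hF : ∀ t ∈ S, ∃ s, ∀ x, F (x + t) = F x + s) :
    ∃ a b : ℝ, 0 < a ∧ ∀ x, F x = a * x + b := by
  -- By density and continuity, `F - F 0` is additive, hence linear.
  have hadd : ∀ x t, F (x + t) - F x = F t - F 0 := by
    intro x t
    have hclosed : IsClosed {t | F (x + t) - F x = F t - F 0} :=
      isClosed_eq ((F.continuous.comp (continuous_const.add continuous_id)).sub continuous_const)
        (F.continuous.sub continuous_const)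
    have hsub : S ⊆ {t | F (x + t) - F x = F t - F 0} := by
      intro t ht
      obtain ⟨s, hs⟩ := hF t ht
      have h0 := hs 0
      rw [zero_add] at h0
      change F (x + t) - F x = F t - F 0
      rw [hs, h0]; ring
    have : t ∈ closure S := hS t
    exact (hclosed.closure_subset_iff.2 hsub) this
  let ℓ : ℝ →+ ℝ := AddMonoidHom.mk' (fun t => F t - F 0) fun s t => by
    have := hadd s t
    linarith
  have hℓ : Continuous ℓ := F.continuous.sub continuous_const
  refine ⟨F 1 - F 0, F 0, sub_pos.2 (F.strictMono one_pos), fun x => ?_⟩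
  have h1 := map_real_smul ℓ hℓ x 1
  have h2 : F (x • 1) - F 0 = x • (F 1 - F 0) := h1
  rw [smul_eq_mul, smul_eq_mul, mul_one] at h2
  linarith

section Holder

variable {φ : G →* HomeoPlus} {A : Subgroup G}

/-- If the translation numbers of an abelian normal subgroup acting freely are dense, then the
action is conjugate to an affine one. -/
theorem IsMinimal.isConjugateToAffine_of_dense [A.Normal] (hφ : IsMinimal φ) {τ : A → ℝ}
    (hadd : ∀ a b, τ (a * b) = τ a + τ b) (hlt : ∀ a b x, τ a < τ b ↔ φ a.1 x < φ b.1 x)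
    (hd : DenseRange τ) : IsConjugateToAffine φ := by
  have h1 : τ 1 = 0 := by
    have := hadd 1 1
    rw [mul_one] at this
    linarith
  have hinv : ∀ a, τ a⁻¹ = -τ a := fun a => by
    have := hadd a⁻¹ a
    rw [inv_mul_cancel, h1] at this
    linarith
  have hle : ∀ a b x, τ a ≤ τ b ↔ φ a.1 x ≤ φ b.1 x := fun a b x => by
    rw [← not_lt, ← not_lt, hlt b a x]
  have hpos : ∀ a x, 0 < τ a ↔ x < φ a.1 x := fun a x => by
    rw [← h1, hlt 1 a x, OneMemClass.coe_one, action_one]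
  obtain ⟨_, ⟨f, rfl⟩, hf⟩ := hd.exists_gt 0
  have hfx : ∀ x, x < φ f.1 x := fun x => (hpos f x).1 hf
  have hne : ∀ x, (τ '' {a | φ a.1 0 ≤ x}).Nonempty := by
    intro x
    obtain ⟨n, hn⟩ := exists_lt_pow hfx x 0
    refine ⟨_, (f ^ n)⁻¹, ?_, rfl⟩
    change φ ((f ^ n)⁻¹ : A).1 0 ≤ x
    rw [Subgroup.coe_inv, Subgroup.coe_pow]
    refine ((action_inv_lt φ _).2 ?_).le
    rwa [map_pow]
  have hbdd : ∀ x, BddAbove (τ '' {a | φ a.1 0 ≤ x}) := by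
    intro x
    obtain ⟨n, hn⟩ := exists_lt_pow hfx 0 x
    refine ⟨τ (f ^ n), ?_⟩
    rintro _ ⟨a, ha, rfl⟩
    rw [hle a (f ^ n) 0, Subgroup.coe_pow, map_pow]
    exact le_trans ha hn.le
  let h : ℝ → ℝ := fun x => sSup (τ '' {a | φ a.1 0 ≤ x})
  have hmono : Monotone h := fun x y hxy =>
    csSup_le_csSup (hbdd y) (hne x) (Set.image_mono fun a ha => le_trans ha hxy)
  have hge : ∀ b x, h x + τ b ≤ h (φ b.1 x) := by
    intro b x
    rw [← le_sub_iff_add_le]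
    refine csSup_le (hne x) ?_
    rintro _ ⟨a, ha, rfl⟩
    rw [le_sub_iff_add_le, add_comm, ← hadd]
    refine le_csSup (hbdd _) ⟨b * a, ?_, rfl⟩
    change φ (b * a : A).1 0 ≤ _
    rw [Subgroup.coe_mul, action_mul]
    exact (φ b.1).monotone ha
  have heq : ∀ b x, h (φ b.1 x) = h x + τ b := by
    intro b x
    refine le_antisymm ?_ (hge b x)
    have := hge b⁻¹ (φ b.1 x)
    rw [Subgroup.coe_inv, action_inv_self, hinv] at this
    linarith
  have hE : ∀ x y, h x < h y → ∃ a : A, x < φ a.1 x ∧ φ a.1 x < y := by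
    intro x y hxy
    obtain ⟨_, ⟨a, rfl⟩, ha⟩ := hd.exists_between (sub_pos.2 hxy)
    refine ⟨a, (hpos a x).1 ha.1, ?_⟩
    by_contra hno
    have := hmono (not_lt.1 hno)
    rw [heq] at this
    linarith [ha.2]
  have hE' : ∀ x y, (∃ a : A, x < φ a.1 x ∧ φ a.1 x < y) → h x < h y := by
    rintro x y ⟨a, ha1, ha2⟩
    have h2 := hmono ha2.le
    rw [heq] at h2
    linarith [(hpos a x).2 ha1]
  -- `hE` and `hE'` express growth of `h` through `A` alone, so normality carries a flat interval
  -- around every point; `h` would be constant, although `f` shifts it.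
  have hstrict : StrictMono h := by
    intro x y hxy
    by_contra hno
    have hloc : IsLocallyConstant h := by
      rw [IsLocallyConstant.iff_eventually_eq]
      intro z
      obtain ⟨g, hg1, hg2⟩ := hφ.exists_mem z hxy
      have hconst : h (φ g⁻¹ y) ≤ h (φ g⁻¹ x) := by
        by_contra hlt'
        obtain ⟨a, ha1, ha2⟩ := hE _ _ (not_le.1 hlt')
        have hconj : g * a.1 * g⁻¹ ∈ A := ‹A.Normal›.conj_mem _ a.2 g
        refine hno (hE' x y ⟨⟨g * a.1 * g⁻¹, hconj⟩, ?_, ?_⟩)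
        · rw [action_mul, action_mul, ← action_inv_lt]; exact ha1
        · rw [action_mul, action_mul, ← lt_action_inv]; exact ha2
      filter_upwards [Ioo_mem_nhds ((action_inv_lt φ g).2 hg1) ((lt_action_inv φ g).2 hg2)]
        with w hw
      have e1 := hmono hw.1.le
      have e2 := hmono hw.2.le
      have e3 := hmono ((action_inv_lt φ g).2 hg1).le
      have e4 := hmono ((lt_action_inv φ g).2 hg2).le
      linarith
    have := hloc.apply_eq_of_isPreconnected isPreconnected_univ (Set.mem_univ (φ f.1 0))
      (Set.mem_univ 0)
    rw [heq] at this
    linarith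
  have hdr : DenseRange h := by
    have : Dense ((fun t => h 0 + t) '' Set.range τ) := by
      have hs : Function.Surjective fun t : ℝ => h 0 + t := fun y => ⟨y - h 0, by simp⟩
      exact hs.denseRange.dense_image (continuous_const.add continuous_id) hd
    refine this.mono ?_
    rintro _ ⟨_, ⟨a, rfl⟩, rfl⟩
    exact ⟨φ a.1 0, heq a 0⟩
  have hcont : Continuous h := hmono.continuous_of_denseRange hdr
  have hsurj : Function.Surjective h := by
    refine hcont.surjective (Filter.tendsto_atTop_atTop_of_monotone hmono fun b => ?_)
      (Filter.tendsto_atBot_atBot_of_monotone hmono fun b => ?_)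
    · obtain ⟨_, ⟨x, rfl⟩, hx⟩ := hdr.exists_gt b
      exact ⟨x, hx.le⟩
    · obtain ⟨_, ⟨x, rfl⟩, hx⟩ := hdr.exists_lt b
      exact ⟨x, hx.le⟩
  let H : HomeoPlus := hstrict.orderIsoOfSurjective h hsurj
  have hH : ∀ x, H x = h x := fun x => rfl
  refine ⟨(MulAut.conj H).toMonoidHom.comp φ, fun g => ?_, H.toHomeomorph, fun g x => ?_⟩
  · refine affine_of_normalizes hd ?_
    rintro _ ⟨a, rfl⟩
    refine ⟨τ ⟨g * a.1 * g⁻¹, ‹A.Normal›.conj_mem _ a.2 g⟩, fun x => ?_⟩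
    obtain ⟨y, rfl⟩ := H.surjective x
    have e1 : H y + τ a = H (φ a.1 y) := (heq a y).symm
    have e2 : ∀ z, (MulAut.conj H).toMonoidHom.comp φ g (H z) = H (φ g z) := fun z => by
      change H (φ g (H.symm (H z))) = _
      rw [OrderIso.symm_apply_apply]
    rw [e1, e2, e2, hH, hH, ← heq]
    simp only [action_mul, action_inv_self]
  · change H (φ g x) = H (φ g (H.symm (H x)))
    rw [OrderIso.symm_apply_apply]

/-- An abelian normal subgroup containing an element without fixed points makes the action affine or
is generated by a single translation. -/
theorem IsMinimal.isConjugateToAffine_or_cyclic [A.Normal] (hφ : IsMinimal φ)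
    (hA : ⁅A, A⁆ ≤ φ.ker) {f : G} (hf : f ∈ A) (hfix : ∀ x, φ f x ≠ x) :
    IsConjugateToAffine φ ∨
      ∃ e ∈ A, (∀ x, x < φ e x) ∧ ∀ a ∈ A, ∃ n : ℤ, φ a = φ e ^ n := by
  obtain ⟨f', hf', hlt⟩ : ∃ f' ∈ A, ∀ x, x < φ f' x := by
    rcases forall_lt_or_forall_gt hfix with h | h
    · exact ⟨f, hf, h⟩
    · exact ⟨f⁻¹, A.inv_mem hf, fun x => (lt_action_inv φ f).2 (h x)⟩
  obtain ⟨τ, hadd, hτ⟩ := exists_translation_number (Q := A.map φ) (by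
    rintro _ ⟨a, ha, rfl⟩ _ ⟨b, hb, rfl⟩
    ext x
    exact action_comm hA ha hb x) (by
    rintro _ ⟨a, ha, rfl⟩ x hx
    exact hφ.eq_one_of_fixed_of_free hA hf' hlt ha hx)
  let σ : A → ℝ := fun a => τ ⟨φ a.1, a.1, a.2, rfl⟩
  have hσ : ∀ a b, σ (a * b) = σ a + σ b := fun a b => by
    have e : (⟨φ (a * b).1, _, (a * b).2, rfl⟩ : A.map φ) =
        ⟨φ a.1, a.1, a.2, rfl⟩ * ⟨φ b.1, b.1, b.2, rfl⟩ := Subtype.ext (map_mul φ a.1 b.1)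
    exact (congrArg τ e).trans (hadd _ _)
  have hσlt : ∀ a b x, σ a < σ b ↔ φ a.1 x < φ b.1 x := fun a b x => hτ _ _ x
  let σ' : Additive A →+ ℝ := AddMonoidHom.mk' (fun a => σ a.toMul) fun a b => hσ _ _
  rcases σ'.range.dense_or_cyclic with hd | ⟨t, ht⟩
  · exact Or.inl (hφ.isConjugateToAffine_of_dense hσ hσlt hd)
  · right
    have h1 : σ 1 = 0 := map_zero σ'
    obtain ⟨e, he⟩ : ∃ e : A, σ e = t := by
      have : t ∈ σ'.range := ht ▸ AddSubgroup.subset_closure rfl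
      obtain ⟨e, he⟩ := this
      exact ⟨e.toMul, he⟩
    have hpow : ∀ a : A, ∃ n : ℤ, φ a.1 = φ e.1 ^ n := by
      intro a
      have : σ a ∈ AddSubgroup.closure {t} := ht ▸ ⟨Additive.ofMul a, rfl⟩
      obtain ⟨n, hn⟩ := AddSubgroup.mem_closure_singleton.1 this
      refine ⟨n, ?_⟩
      have hz : σ (e ^ n) = σ a := by
        rw [← hn, ← he]
        exact map_zsmul σ' n (Additive.ofMul e)
      rw [← map_zpow]
      ext x
      refine le_antisymm (not_lt.1 fun h => ?_) (not_lt.1 fun h => ?_)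
      · exact absurd ((hσlt (e ^ n) a x).2 h) (by rw [hz]; exact lt_irrefl _)
      · exact absurd ((hσlt a (e ^ n) x).2 h) (by rw [hz]; exact lt_irrefl _)
    have hefix : ∀ x, φ e.1 x ≠ x := by
      intro x hx
      obtain ⟨n, hn⟩ := hpow ⟨f', hf'⟩
      have := hlt x
      rw [hn, zpow_apply_eq_self hx] at this
      exact lt_irrefl _ this
    rcases forall_lt_or_forall_gt hefix with h | h
    · exact ⟨e, e.2, h, fun a ha => hpow ⟨a, ha⟩⟩
    · refine ⟨e.1⁻¹, A.inv_mem e.2, fun x => (lt_action_inv φ _).2 (h x), fun a ha => ?_⟩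
      obtain ⟨n, hn⟩ := hpow ⟨a, ha⟩
      exact ⟨-n, by rw [map_inv, inv_zpow', neg_neg, hn]⟩

/-- A normal subgroup generated by a translation is central. -/
theorem commute_of_cyclic [A.Normal] {e : G} (he : e ∈ A) (hlt : ∀ x, x < φ e x)
    (hcyc : ∀ a ∈ A, ∃ n : ℤ, φ a = φ e ^ n) (g : G) : Commute (φ e) (φ g) := by
  obtain ⟨n, hn⟩ := hcyc _ (‹A.Normal›.conj_mem e he g)
  obtain ⟨m, hm⟩ := hcyc _ (‹A.Normal›.conj_mem e he g⁻¹)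
  have hinj := (strictMono_zpow hlt 0)
  -- Conjugation by `g` and by `g⁻¹` raises `φ e` to inverse exponents, and preservation of
  -- orientation leaves only `1`.
  have hmn : m * n = 1 := by
    refine hinj.injective ?_
    have h1 : φ e = (φ e ^ m) ^ n := by
      rw [← hm, ← map_zpow, conj_zpow, map_mul, map_mul, map_zpow, ← hn]
      simp only [map_mul, map_inv]
      group
    rw [← zpow_mul] at h1
    simp only [zpow_one]
    rw [← h1]
  have hpos : 0 < n := by
    refine hinj.lt_iff_lt.1 ?_
    simp only [zpow_zero]
    rw [← hn, action_mul, action_mul, ← action_inv_lt]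
    exact hlt _
  have hn1 : n = 1 := by
    rcases Int.eq_one_or_neg_one_of_mul_eq_one (by rwa [mul_comm] at hmn) with h | h <;> omega
  rw [hn1, zpow_one, map_mul, map_mul, map_inv, mul_inv_eq_iff_eq_mul] at hn
  exact hn.symm

/-- A finite index subgroup of a minimal action is not generated by a central translation. -/
theorem IsMinimal.not_finiteIndex_of_cyclic (hφ : IsMinimal φ) [A.FiniteIndex] {e : G}
    (hlt : ∀ x, x < φ e x) (hcent : ∀ g, Commute (φ e) (φ g))
    (hcyc : ∀ a ∈ A, ∃ n : ℤ, φ a = φ e ^ n) : False := by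
  -- Each coset contributes one point of the fundamental domain, so the orbit of `0` is finite
  -- there.
  choose m hm1 hm2 using fun q : G ⧸ A => exists_zpow_mem hlt 0 (φ q.out 0)
  have hsub : Set.Ioo 0 (φ e 0) ∩ Set.range (fun g : G => φ g 0) ⊆
      Set.range fun q : G ⧸ A => (φ e ^ m q) (φ q.out 0) := by
    rintro _ ⟨hmem, g, rfl⟩
    refine ⟨(g : G ⧸ A), ?_⟩
    obtain ⟨a, ha⟩ := QuotientGroup.mk_out_eq_mul A g
    obtain ⟨n, hn⟩ := hcyc a.1 a.2
    have hg : (φ e ^ n) (φ g 0) = φ (g : G ⧸ A).out 0 := by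
      rw [ha, map_mul, hn, ← ((hcent g).zpow_left n).eq, RelIso.mul_apply]
    have h1 := hm1 (g : G ⧸ A)
    have h2 := hm2 (g : G ⧸ A)
    simp only
    rw [← hg, ← RelIso.mul_apply, ← zpow_add] at h1 h2 ⊢
    have h0 : m (g : G ⧸ A) + n = 0 :=
      zpow_unique hlt h1 h2 (n := 0) hmem.1.le hmem.2
    rw [h0]
    rfl
  have hfin : (Set.range fun q : G ⧸ A => (φ e ^ m q) (φ q.out 0)).Finite := Set.finite_range _
  have h3 := (hφ 0).open_subset_closure_inter (isOpen_Ioo (a := 0) (b := φ e 0))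
  have h4 := (h3.trans (closure_mono hsub)).trans hfin.isClosed.closure_subset
  exact Set.Ioo_infinite (hlt 0) (hfin.subset h4)

/-- In a virtually solvable group, an abelian normal subgroup containing an element without fixed
points makes the action affine. -/
theorem IsMinimal.isConjugateToAffine_of_free [A.Normal] (hφ : IsMinimal φ)
    (hA : ⁅A, A⁆ ≤ φ.ker) {D : ℕ → Subgroup G} [∀ i, (D i).Normal] [(D 0).FiniteIndex]
    (hD : ∀ i, ⁅D i, D i⁆ ≤ D (i + 1)) {d : ℕ} (hd : D d = ⊥) {f : G} (hf : f ∈ A)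
    (hfix : ∀ x, φ f x ≠ x) : IsConjugateToAffine φ := by
  by_contra hno
  -- If the action is not affine, `B` is cyclic and central in the image, so commutators of the next
  -- larger term are powers of `φ e`, hence trivial, and `B` can absorb that term.
  have key : ∀ k : ℕ, k ≤ d → ∃ B : Subgroup G, B.Normal ∧ ⁅B, B⁆ ≤ φ.ker ∧ D (d - k) ≤ B ∧
      f ∈ B := by
    intro k
    induction k with
    | zero =>
      intro _
      exact ⟨A, inferInstance, hA, by rw [tsub_zero, hd]; exact bot_le, hf⟩
    | succ k ih =>
      intro hk
      obtain ⟨B, hB, hBB, hDB, hfB⟩ := ih (by omega)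
      obtain ⟨e, he, hlt, hcyc⟩ := (hφ.isConjugateToAffine_or_cyclic hBB hfB hfix).resolve_left hno
      have hcent := commute_of_cyclic he hlt hcyc
      have hker : ∀ b ∈ B, ∀ g : G, b * g * b⁻¹ * g⁻¹ ∈ φ.ker := by
        intro b hb g
        obtain ⟨n, hn⟩ := hcyc b hb
        rw [MonoidHom.mem_ker, map_mul, map_mul, map_mul, map_inv, map_inv, hn,
          ((hcent g).zpow_left n).eq, mul_inv_cancel_right, mul_inv_cancel]
      have h1 : ∀ X : Subgroup G, ⁅B, X⁆ ≤ φ.ker := fun X =>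
        Subgroup.commutator_le.2 fun b hb g _ => hker b hb g
      have h2 : ⁅D (d - (k + 1)), D (d - (k + 1))⁆ ≤ φ.ker := by
        refine Subgroup.commutator_le.2 fun x hx y hy => ?_
        have hmem : x * y * x⁻¹ * y⁻¹ ∈ B := by
          have := commutator_mem (hD (d - (k + 1))) hx hy
          rw [show d - (k + 1) + 1 = d - k by omega] at this
          exact hDB this
        obtain ⟨n, hn⟩ := hcyc _ hmem
        have hn0 : n = 0 := eq_zero_of_commutator_eq_zpow hlt (hcent x) (hcent y) (by
          rw [← hn]; simp only [map_mul, map_inv])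
        rw [hn0, zpow_zero] at hn
        exact hn
      refine ⟨B ⊔ D (d - (k + 1)), inferInstance, ?_, le_sup_right, Subgroup.mem_sup_left hfB⟩
      refine sup_commutator_le (h1 _) ?_
      rw [Subgroup.commutator_comm]
      exact sup_commutator_le (h1 _) h2
  obtain ⟨B, hB, hBB, hDB, hfB⟩ := key d le_rfl
  rw [tsub_self] at hDB
  obtain ⟨e, he, hlt, hcyc⟩ := (hφ.isConjugateToAffine_or_cyclic hBB hfB hfix).resolve_left hno
  have : B.FiniteIndex := Subgroup.finiteIndex_of_le hDB
  exact hφ.not_finiteIndex_of_cyclic hlt (commute_of_cyclic he hlt hcyc) hcyc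

end Holder

end LineAction

/-! ### Affine and laminar actions exclude each other. -/

namespace LineAction

variable {G : Type*} [Group G]

section Exclusive

variable {φ ψ : G →* HomeoPlus}

/-- A minimal affine action contains arbitrarily small translations. -/
theorem IsMinimal.exists_small_translation (hψ : IsMinimal ψ) (haff : IsAffine ψ) {ε : ℝ}
    (hε : 0 < ε) : ∃ (g : G) (b : ℝ), b ≠ 0 ∧ |b| < ε ∧ ∀ x, ψ g x = x + b := by
  by_cases h1 : ∃ (g : G) (a b : ℝ), 0 < a ∧ a < 1 ∧ ∀ x, ψ g x = a * x + b
  · obtain ⟨g, a, b, ha, ha1, hg⟩ := h1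
    have ha1' : 1 - a ≠ 0 := by linarith
    have hginv : ∀ x, ψ g⁻¹ x = (x - b) / a := fun x => by
      rw [eq_div_iff ha.ne']
      have := action_self_inv ψ g x
      rw [hg] at this
      linarith
    -- This point is fixed by `g`. Since `k` moves it, their commutator is a non-trivial
    -- translation, which conjugation by `g` scales by `a < 1`.
    obtain ⟨k, hk⟩ := hψ.isIrreducible (b / (1 - a))
    obtain ⟨c, d, hc, hkx⟩ := haff k
    have hkinv : ∀ x, ψ k⁻¹ x = (x - d) / c := fun x => by
      rw [eq_div_iff hc.ne']
      have := action_self_inv ψ k x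
      rw [hkx] at this
      linarith
    have ht : ∀ x, ψ (k * g * k⁻¹ * g⁻¹) x = x + ((1 - a) * d + (c - 1) * b) := fun x => by
      rw [action_mul, action_mul, action_mul, hginv, hkinv, hg, hkx]
      field_simp
      ring
    have hne : (1 - a) * d + (c - 1) * b ≠ 0 := by
      intro h0
      refine hk ?_
      rw [hkx]
      field_simp
      linarith
    generalize (1 - a) * d + (c - 1) * b = t at ht hne
    have hpow : ∀ n : ℕ, ∃ s : G, ∀ x, ψ s x = x + a ^ n * t := by
      intro n
      induction n with
      | zero => exact ⟨_, fun x => by rw [ht, pow_zero, one_mul]⟩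
      | succ n ih =>
        obtain ⟨s, hs⟩ := ih
        refine ⟨g * s * g⁻¹, fun x => ?_⟩
        rw [action_mul, action_mul, hginv, hs, hg, pow_succ]
        field_simp
        ring
    obtain ⟨n, hn⟩ := exists_pow_lt_of_lt_one (div_pos hε (abs_pos.2 hne)) ha1
    obtain ⟨s, hs⟩ := hpow n
    refine ⟨s, a ^ n * t, mul_ne_zero (pow_pos ha n).ne' hne, ?_, hs⟩
    rw [abs_mul, abs_of_pos (pow_pos ha n)]
    exact (lt_div_iff₀ (abs_pos.2 hne)).1 hn
  · have hone : ∀ g : G, ∃ b : ℝ, ∀ x, ψ g x = x + b := by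
      intro g
      obtain ⟨a, b, ha, hg⟩ := haff g
      rcases lt_trichotomy a 1 with h | rfl | h
      · exact absurd ⟨g, a, b, ha, h, hg⟩ h1
      · exact ⟨b, fun x => by rw [hg, one_mul]⟩
      · refine absurd ⟨g⁻¹, a⁻¹, -(a⁻¹ * b), inv_pos.2 ha, inv_lt_one_of_one_lt₀ h, fun x => ?_⟩ h1
        have := action_self_inv ψ g x
        rw [hg] at this
        rw [← sub_eq_add_neg, ← mul_sub, eq_inv_mul_iff_mul_eq₀ ha.ne']
        linarith
    obtain ⟨g, hg0, hgε⟩ := hψ.exists_mem 0 hε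
    obtain ⟨b, hb⟩ := hone g
    rw [hb, zero_add] at hg0 hgε
    exact ⟨g, b, hg0.ne', by rwa [abs_of_pos hg0], hb⟩

/-- A small translation moves both ends of an interval the same way by less than its length, so
interval and image cross. -/
theorem IsMinimal.not_isLaminar_of_affine (hφ : IsMinimal φ) (h : IsConjugateToAffine φ) :
    ¬ IsLaminar φ := by
  rintro ⟨-, L, hL, hcov, hinv⟩
  obtain ⟨ψ, haff, h, hh⟩ := h
  have hψ : IsMinimal ψ := fun x => by
    have h1 : DenseRange fun g : G => φ g (h.symm x) := hφ _
    have h2 := h.surjective.denseRange.comp h1 h.continuous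
    have h3 : (h ∘ fun g : G => φ g (h.symm x)) = fun g : G => ψ g x := by
      ext g
      simp only [Function.comp_apply, hh, Homeomorph.apply_symm_apply]
    rwa [h3] at h2
  obtain ⟨I, hI, -⟩ := hcov 0
  obtain ⟨ε₁, hε₁, h1⟩ := Metric.continuous_iff.1 h.symm.continuous (h I.1.1) _ (sub_pos.2 I.2)
  obtain ⟨ε₂, hε₂, h2⟩ := Metric.continuous_iff.1 h.symm.continuous (h I.1.2) _ (sub_pos.2 I.2)
  obtain ⟨g, b, hb, hbε, hg⟩ := hψ.exists_small_translation haff (lt_min hε₁ hε₂)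
  rw [lt_min_iff] at hbε
  have hval : ∀ x, φ g x = h.symm (h x + b) := fun x => by
    rw [← hg, ← hh, Homeomorph.symm_apply_apply]
  have h1 := h1 (h I.1.1 + b) (by rw [Real.dist_eq, add_sub_cancel_left]; exact hbε.1)
  have h2 := h2 (h I.1.2 + b) (by rw [Real.dist_eq, add_sub_cancel_left]; exact hbε.2)
  rw [← hval, Homeomorph.symm_apply_apply, Real.dist_eq, abs_lt] at h1 h2
  have hfix : ∀ x, φ g x ≠ x := fun x hx => by
    have := hh g x
    rw [hg, hx] at this
    exact hb (by linarith)
  have hgI := hinv g I hI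
  rcases forall_lt_or_forall_gt hfix with hlt | hlt
  · refine isPrelamination_iff.1 hL I hI _ hgI (hlt _) ?_ (hlt _)
    rw [OpenInterval.map_fst]
    linarith
  · refine isPrelamination_iff.1 hL _ hgI I hI (hlt _) ?_ (hlt _)
    rw [OpenInterval.map_snd]
    linarith

end Exclusive

/-! ### Assembling the dichotomy. -/

section Main

/-- A virtually solvable group has a solvable normal subgroup of finite index, whose derived series
consists of normal subgroups. -/
theorem IsVirtuallySolvable.exists_derived (hG : IsVirtuallySolvable G) :
    ∃ (D : ℕ → Subgroup G) (d : ℕ), (∀ i, (D i).Normal) ∧ (D 0).FiniteIndex ∧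
      (∀ i, ⁅D i, D i⁆ ≤ D (i + 1)) ∧ D d = ⊥ := by
  obtain ⟨H, hH, hfin⟩ := hG
  -- Inside the normal core, derived subgroups are characteristic, hence normal in `G`.
  let C := H.normalCore
  have hC : Group.IsSolvable C :=
    Group.isSolvable_of_isSolvable_injective (Subgroup.inclusion_injective H.normalCore_le)
  obtain ⟨d, hd⟩ := hC.solvable
  refine ⟨fun i => (derivedSeries C i).map C.subtype, d, fun i => ?_, ?_, fun i => ?_, ?_⟩
  · infer_instance
  · simp only
    rw [derivedSeries_zero, ← MonoidHom.range_eq_map, Subgroup.range_subtype]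
    infer_instance
  · simp only
    rw [derivedSeries_succ, Subgroup.map_commutator]
  · simp only [hd, Subgroup.map_bot]

/-- An action through a finite quotient has finite orbits. -/
theorem IsMinimal.not_le_ker {φ : G →* HomeoPlus} (hφ : IsMinimal φ) (D : Subgroup G)
    [D.FiniteIndex] : ¬ D ≤ φ.ker := by
  intro h
  have : φ.ker.FiniteIndex := Subgroup.finiteIndex_of_le h
  have hsub : (Set.range fun g : G => φ g 0) ⊆ Set.range fun q : G ⧸ φ.ker => φ q.out 0 := by
    rintro _ ⟨g, rfl⟩
    refine ⟨(g : G ⧸ φ.ker), ?_⟩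
    obtain ⟨a, ha⟩ := QuotientGroup.mk_out_eq_mul φ.ker g
    simp only
    rw [ha, map_mul, show φ a.1 = 1 from a.2, mul_one]
  have hfin := (Set.finite_range fun q : G ⧸ φ.ker => φ q.out 0).subset hsub
  have hd := (hφ 0).closure_eq
  rw [hfin.isClosed.closure_eq] at hd
  exact Set.infinite_univ (hd ▸ hfin)

/-- A minimal action of a virtually solvable group is affine up to conjugacy, or it is laminar and
horograded by an action of the quotient by the Fitting subgroup. -/
theorem IsMinimal.isConjugateToAffine_or_horograded [Group.FG G] (hG : IsVirtuallySolvable G)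
    {φ : G →* HomeoPlus} (hφ : IsMinimal φ) :
    IsConjugateToAffine φ ∨
      ∃ j : G →* HomeoPlus, IsHorogradedBy φ j ∧ fitting G ≤ j.ker ∧ (IsMinimal j ∨ IsCyclic j) := by
  classical
  obtain ⟨D, d, hnormal, hfin, hD, hd⟩ := hG.exists_derived
  have hex : ∃ m, D m ≤ φ.ker := ⟨d, by rw [hd]; exact bot_le⟩
  -- `D m` is the last term acting non-trivially, so its image is abelian.
  obtain ⟨m, hm⟩ : ∃ m, Nat.find hex = m + 1 :=
    Nat.exists_eq_succ_of_ne_zero fun h0 => hφ.not_le_ker (D 0) (h0 ▸ Nat.find_spec hex)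
  have hA : ⁅D m, D m⁆ ≤ φ.ker := (hD m).trans (hm ▸ Nat.find_spec hex)
  obtain ⟨a, ha, hne⟩ := SetLike.not_le_iff_exists.1
    (Nat.find_min hex (by omega : m < Nat.find hex))
  by_cases hfree : ∃ f ∈ D m, ∀ x, φ f x ≠ x
  · obtain ⟨f, hf, hfix⟩ := hfree
    exact Or.inl (hφ.isConjugateToAffine_of_free hA hD hd hf hfix)
  · push Not at hfree
    right
    have hpre := isPrelamination_supportComponents hA
    have hinv : IsInvariant φ (supportComponents φ (D m)) := isInvariant_supportComponents
    have hell : IsElliptic φ (fitting G) (supportComponents φ (D m)) :=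
      isElliptic_supportComponents hA fun f hf a _ => by
        obtain ⟨k, hk⟩ := engel_of_mem_fitting hf a
        exact ⟨k, by rw [hk, map_one]⟩
    have hL : IsEllipticLamination φ (fitting G) (closure (supportComponents φ (D m))) :=
      { nonempty := (hφ.supportComponents_nonempty hA ha hne (hfree a ha)).closure
        prelamination := hpre.closure
        closed := isClosed_closure
        invariant := hinv.closure
        elliptic := hell.closure hpre hinv }
    obtain ⟨N, L, hN, hle, hL, htot, I, hI, g, hs, hne⟩ := exists_total_lamination hφ hD hd hL
    obtain ⟨j, hj, hker, hmin⟩ := hL.exists_horograding hφ htot hI hs hne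
    exact ⟨j, hj, hle.trans hker, hmin⟩

end Main

end LineAction

theorem theoremD {G : Type*} [Group G] [Group.FG G]
    (hG : LineAction.IsVirtuallySolvable G)
    (φ : G →* LineAction.HomeoPlus) (hφ : LineAction.IsMinimal φ) :
    Xor (∃ ψ : G →* LineAction.HomeoPlus, LineAction.IsAffine ψ ∧ LineAction.IsConjugate φ ψ)
        (LineAction.IsLaminar φ) ∧
      (LineAction.IsLaminar φ →
        ∃ j : G →* LineAction.HomeoPlus,
          LineAction.IsHorogradedBy φ j ∧
          LineAction.fitting G ≤ j.ker ∧
          (LineAction.IsMinimal j ∨ LineAction.IsCyclic j)) := by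
  have hex := hφ.not_isLaminar_of_affine
  rcases hφ.isConjugateToAffine_or_horograded hG with h | h
  · exact ⟨Or.inl ⟨h, hex h⟩, fun hlam => absurd hlam (hex h)⟩
  · obtain ⟨j, ⟨L, hor, hj⟩, hj'⟩ := h
    exact ⟨Or.inr ⟨hj.laminar, fun ha => hex ha hj.laminar⟩, fun _ => ⟨j, ⟨L, hor, hj⟩, hj'⟩⟩
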